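/- **Setting.** A hexagonal system $(\mathbb J,\mathbb F,\#)$ consists of a commutative field $\mathbb F$, an $\mathbb F$-vector space $\mathbb J$ and a map $\#:\mathbb J\to\mathbb J$, together with the norm $\mathsf N:\mathbb J\to\mathbb F$, symmetric bilinear maps $\mathsf T:\mathbb J\times\mathbb J\to\mathbb F$ and $\times:\mathbb J\times\mathbb J\to\mathbb J$ and an element $1\in\mathbb J\setminus\{0\}$ such that for all $t\in\mathbb F$ and $a,b,c\in\mathbb J$: $(ta)^\#=t^2a^\#$; $\mathsf N(ta)=t^3\mathsf N(a)$; $\mathsf T(a,b\times c)=\mathsf T(a\times b,c)$; $(a+b)^\#=a^\#+a\times b+b^\#$; $\mathsf N(a+b)=\mathsf N(a)+\mathsf T(a^\#,b)+\mathsf T(a,b^\#)+\mathsf N(b)$; $\mathsf T(a,a^\#)=3\mathsf N(a)$; $a^{\#\#}=\mathsf N(a)a$; $a^\#\times(a\times b)=\mathsf N(a)b+\mathsf T(a^\#,b)a$; $a^\#\times b^\#+(a\times b)^\#=\mathsf T(a^\#,b)b+\mathsf T(a,b^\#)a$; $1^\#=1$; $b=\mathsf T(b,1)1-1\times b$; $\mathsf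 N(a)=0\iff a=0$. Let $\Gamma$ be a Moufang hexagon (a thick generalised hexagon satisfying the Moufang condition) with full collineation group $G$, and let $v_i$ ($i\in\mathbb Z/12$) be the elements of an ordinary hexagon $A_0$ of $\Gamma$ in cyclic order, where $p_0=v_7$ is a point and $L_0=v_6$ is a line. Let $U_i\le G$ be the root group of the path $(v_i,\dots,v_{i+6})$, that is, the group of all collineations fixing every element incident with one of $v_{i+1},\dots,v_{i+5}$. Suppose that $\Gamma$ is associated to the hexagonal system $(\mathbb J,\mathbb F,\#)$, that is, there are isomorphisms $x_i:(\mathbb J,+)\to U_i$ for $i=1,3,5$ and $x_i:(\mathbb F,+)\to U_i$ for $i=2,4,6$ such that, with $[g,h]=g^{-1}h^{-1}gh$, $$[x_1(a),x_3(b)]=x_2(\mathsf T(a,b)),\qquad [x_3(a),x_5(b)]=x_4(\mathsf T(a,b)),\qquad [x_2(t),x_6(u)]=x_4(tu),$$ $$[x_1(a),x_5(b)]=x_2(-\mathsf T(a^\#,b))\,x_3(a\times b)\,x_4(\mathsf T(a,b^\#)),$$ $$[x_1(a),x_6(t)]=x_2(-t\mathsf N(a))\,x_3(ta^\#)\,x_4(t^2\mathsf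 N(a))\,x_5(-ta),$$ and $[U_i,U_j]=1$ for all other pairs $1\le i<j\le 6$. **Theorem.** There are $s_1,s_6\in G$ that stabilise $A_0$ and induce on it the reflections $v_j\mapsto v_{14-j}$ (fixing $p_0$) and $v_j\mapsto v_{12-j}$ (fixing $L_0$), respectively. For any such $s_1,s_6$, and for $t,t',t'',u,u'\in\mathbb F$ and $a,a',b,b',b''\in\mathbb J$, define points $$(\infty)=p_0,\quad (t)=x_6(t)s_6\,p_0,\quad (b,u)=x_1(b)x_2(u)s_1s_6\,p_0,\quad (t,a,t')=x_6(t)x_5(a)x_4(t')s_6s_1s_6\,p_0,$$ $$(b,u,b',u')=x_1(b)x_2(u)x_3(b')x_4(u')s_1s_6s_1s_6\,p_0,\quad (t,a,t',a',t'')=x_6(t)x_5(a)x_4(t')x_3(a')x_2(t'')s_6s_1s_6s_1s_6\,p_0$$ and lines $$[\infty]=L_0,\quad [b]=x_1(b)s_1\,L_0,\quad [t,a]=x_6(t)x_5(a)s_6s_1\,L_0,\quad [b,u,b']=x_1(b)x_2(u)x_3(b')s_1s_6s_1\,L_0,$$ $$[t,a,t',a']=x_6(t)x_5(a)x_4(t')x_3(a')s_6s_1s_6s_1\,L_0,\quad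 [b,u,b',u',b'']=x_1(b)x_2(u)x_3(b')x_4(u')x_5(b'')s_1s_6s_1s_6s_1\,L_0.$$ Then every point and every line of $\Gamma$ has exactly one such label, and the incidence relation $*$ is given as follows. One has $$(t,a,t',a',t'')*[t,a,t',a']*(t,a,t')*[t,a]*(t)*[\infty]*(\infty)*[b]*(b,u)*[b,u,b']*(b,u,b',u')*[b,u,b',u',b''],$$ and, apart from pairs consisting of a point labelled by a $5$-tuple and a line labelled by a $5$-tuple, there are no other incidences. Moreover $(t,a,t',a',t'')*[b,u,b',u',b'']$ if and only if $$\begin{aligned}u&=t''+t\mathsf N(b)-\mathsf T(a',b)+\mathsf T(a,b^\#)\\ b'&=a'-(a\times b)-tb^\#\\ u'&=t'+t^2\mathsf N(b)-tt''+t\mathsf T(a,b^\#)+\mathsf T(a^\#,b)-\mathsf T(a,a')\\ b''&=a+tb,\end{aligned}$$ if and only if $$\begin{aligned}a&=b''-tb\\ t'&=u'+t^2\mathsf N(b)+ut-t\mathsf T(b'',b^\#)+\mathsf T(b',b'')+\mathsf T(b''^\#,b)\\ a'&=b'+b\times b''-tb^\#\\ t''&=u-t\mathsf N(b)+\mathsf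 T(b,b')+\mathsf T(b'',b^\#).\end{aligned}$$ -/

import Mathlib

/-- A hexagonal system `(J, F, #)`: the adjoint `#`, together with the norm `N`, the trace form `T`,
the symmetric bilinear product `×` and the identity element that belong to it. -/
structure HexagonalSystem (F J : Type*) [Field F] [AddCommGroup J] [Module F J] where
  /-- the norm -/
  N : J → F
  /-- the adjoint, written `a ↦ a^#` -/
  sharp : J → J
  /-- the trace form -/
  T : J →ₗ[F] J →ₗ[F] F
  /-- the product, written `a × b` -/
  cross : J →ₗ[F] J →ₗ[F] J
  /-- the identity element -/
  one : J
  one_ne_zero : one ≠ 0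
  T_symm : ∀ a b, T a b = T b a
  cross_symm : ∀ a b, cross a b = cross b a
  sharp_smul : ∀ (t : F) (a : J), sharp (t • a) = t ^ 2 • sharp a
  N_smul : ∀ (t : F) (a : J), N (t • a) = t ^ 3 * N a
  T_cross : ∀ a b c, T a (cross b c) = T (cross a b) c
  sharp_add : ∀ a b, sharp (a + b) = sharp a + cross a b + sharp b
  N_add : ∀ a b, N (a + b) = N a + T (sharp a) b + T a (sharp b) + N b
  T_sharp : ∀ a, T a (sharp a) = 3 * N a
  sharp_sharp : ∀ a, sharp (sharp a) = N a • a
  sharp_cross_cross : ∀ a b, cross (sharp a) (cross a b) = N a • b + T (sharp a) b • a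
  sharp_cross_sharp : ∀ a b,
    cross (sharp a) (sharp b) + sharp (cross a b) = T (sharp a) b • b + T a (sharp b) • a
  sharp_one : sharp one = one
  eq_trace_sub : ∀ b, b = T b one • one - cross one b
  N_eq_zero : ∀ a, N a = 0 ↔ a = 0

/-- A point-line geometry with point set `P` and line set `L`. -/
structure PointLineGeometry (P L : Type*) where
  /-- incidence of a point with a line -/
  Inc : P → L → Prop

namespace PointLineGeometry

variable {P L : Type*} (Γ : PointLineGeometry P L)

/-- Adjacency of two elements (points or lines) in the incidence graph. -/
def Adj : P ⊕ L → P ⊕ L → Prop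
  | Sum.inl p, Sum.inr l => Γ.Inc p l
  | Sum.inr l, Sum.inl p => Γ.Inc p l
  | _, _ => False

/-- The elements `v 0, v 1, …, v (2k - 1)`, in this cyclic order, form an ordinary `k`-gon
(with `k ≥ 2`). -/
def IsOrdinaryGon (k : ℕ) (v : ZMod (2 * k) → P ⊕ L) : Prop :=
  Function.Injective v ∧ ∀ i, Γ.Adj (v i) (v (i + 1))

/-- Generalised hexagons: nonempty geometries without ordinary `2`-, `3`-, `4`- and `5`-gons in
which any two elements lie in a common ordinary hexagon. -/
def IsGeneralisedHexagon : Prop :=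
  Nonempty (P ⊕ L) ∧
  (∀ k, 2 ≤ k → k ≤ 5 → ∀ v : ZMod (2 * k) → P ⊕ L, ¬ Γ.IsOrdinaryGon k v) ∧
  (∀ x y : P ⊕ L, ∃ v : ZMod (2 * 6) → P ⊕ L,
    Γ.IsOrdinaryGon 6 v ∧ x ∈ Set.range v ∧ y ∈ Set.range v)

/-- Each line contains at least three points and each point is on at least three lines. -/
def IsThick : Prop :=
  (∀ l, 3 ≤ {p | Γ.Inc p l}.encard) ∧ (∀ p, 3 ≤ {l | Γ.Inc p l}.encard)

/-- The full collineation group: pairs of a permutation of the points and a permutation of the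
lines which preserve incidence in both directions. -/
def collineationGroup : Subgroup (Equiv.Perm P × Equiv.Perm L) where
  carrier := {g | ∀ p l, Γ.Inc (g.1 p) (g.2 l) ↔ Γ.Inc p l}
  one_mem' := fun _ _ => Iff.rfl
  mul_mem' := fun {g h} hg hh p l => (hg (h.1 p) (h.2 l)).trans (hh p l)
  inv_mem' := fun {g} hg p l => by
    have h := hg (g.1⁻¹ p) (g.2⁻¹ l)
    rw [show g.1 (g.1⁻¹ p) = p from g.1.apply_symm_apply p,
      show g.2 (g.2⁻¹ l) = l from g.2.apply_symm_apply l] at h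
    exact h.symm

/-- A collineation. -/
abbrev Collineation := Γ.collineationGroup

variable {Γ}

/-- The image of a point under a collineation. -/
def Collineation.onPoint (g : Γ.Collineation) (p : P) : P := g.1.1 p

/-- The image of a line under a collineation. -/
def Collineation.onLine (g : Γ.Collineation) (l : L) : L := g.1.2 l

/-- The image of an element (a point or a line) under a collineation. -/
def Collineation.act (g : Γ.Collineation) : P ⊕ L → P ⊕ L :=
  Sum.map (Collineation.onPoint g) (Collineation.onLine g)

variable (Γ)

/-- The root group of a path `γ 0, …, γ 6`: all collineations fixing every element that is
incident with one of the inner elements `γ 1, …, γ 5`. -/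
def rootGroup (γ : Fin 7 → P ⊕ L) : Subgroup Γ.Collineation where
  carrier := {g | ∀ i, 0 < i → i < 6 → ∀ y, Γ.Adj (γ i) y → Collineation.act g y = y}
  one_mem' := fun _ _ _ y _ => by cases y <;> rfl
  mul_mem' := fun {g h} hg hh i h0 h6 y hy => by
    have e : Collineation.act (g * h) y = Collineation.act g (Collineation.act h y) := by
      cases y <;> rfl
    rw [e, hh i h0 h6 y hy, hg i h0 h6 y hy]
  inv_mem' := fun {g} hg i h0 h6 y hy => by
    have e : Collineation.act g⁻¹ (Collineation.act g y) = y := by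
      cases y
      · exact congrArg Sum.inl (g.1.1.symm_apply_apply _)
      · exact congrArg Sum.inr (g.1.2.symm_apply_apply _)
    rwa [hg i h0 h6 y hy] at e

/-- A root: a path of length six in the incidence graph without repeated elements. -/
def IsRoot (γ : Fin 7 → P ⊕ L) : Prop :=
  Function.Injective γ ∧ ∀ i : Fin 6, Γ.Adj (γ i.castSucc) (γ i.succ)

/-- Moufang hexagons: thick generalised hexagons in which the root group of every root
`(γ 0, …, γ 6)` is transitive on the elements incident with `γ 0` and different from `γ 1`. -/
def IsMoufangHexagon : Prop :=
  Γ.IsGeneralisedHexagon ∧ Γ.IsThick ∧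
  ∀ γ : Fin 7 → P ⊕ L, Γ.IsRoot γ →
    ∀ y y', Γ.Adj (γ 0) y → y ≠ γ 1 → Γ.Adj (γ 0) y' → y' ≠ γ 1 →
      ∃ g ∈ Γ.rootGroup γ, Collineation.act g y = y'

end PointLineGeometry

/-- The commutator `[g, h] = g⁻¹ h⁻¹ g h`. -/
def rootCommutator {G : Type*} [Group G] (g h : G) : G := g⁻¹ * h⁻¹ * g * h

/-- `x : A → G` is an isomorphism of the additive group `A` with the subgroup `U` of `G`. -/
def ParametrisesSubgroup {A G : Type*} [AddGroup A] [Group G] (x : A → G) (U : Subgroup G) : Prop :=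
  (∀ a b, x (a + b) = x a * x b) ∧ Function.Injective x ∧ Set.range x = (U : Set G)

/-- What it means that the geometry `Γ` is associated to the hexagonal system `H`: an apartment
`v 0, …, v 11` of `Γ` (an ordinary hexagon) containing the base chamber `{p₀, L₀}`, where
`p₀ = v 7` and `L₀ = v 6`, and parametrisations `x₁, …, x₆` of the six positive root groups
`U₁, …, U₆` that satisfy the commutator relations defined by `H`. Here `U_i` is the root group of
the path `(v i, …, v (i + 6))`; these are the roots of the apartment that contain the base chamber.
So `U₁` acts on the lines through `p₀` and `U₆` acts on the points on `L₀`. -/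
structure HexagonLabelling {P L F J : Type*} [Field F] [AddCommGroup J] [Module F J]
    (Γ : PointLineGeometry P L) (H : HexagonalSystem F J) where
  /-- the base apartment -/
  v : ZMod (2 * 6) → P ⊕ L
  /-- the base point -/
  p₀ : P
  /-- the base line -/
  L₀ : L
  apartment : Γ.IsOrdinaryGon 6 v
  v_seven : v 7 = Sum.inl p₀
  v_six : v 6 = Sum.inr L₀
  /-- parametrisation of `U₁` -/
  x₁ : J → Γ.Collineation
  /-- parametrisation of `U₂` -/
  x₂ : F → Γ.Collineation
  /-- parametrisation of `U₃` -/
  x₃ : J → Γ.Collineation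
  /-- parametrisation of `U₄` -/
  x₄ : F → Γ.Collineation
  /-- parametrisation of `U₅` -/
  x₅ : J → Γ.Collineation
  /-- parametrisation of `U₆` -/
  x₆ : F → Γ.Collineation
  param₁ : ParametrisesSubgroup x₁ (Γ.rootGroup fun k => v (1 + (k : ℕ)))
  param₂ : ParametrisesSubgroup x₂ (Γ.rootGroup fun k => v (2 + (k : ℕ)))
  param₃ : ParametrisesSubgroup x₃ (Γ.rootGroup fun k => v (3 + (k : ℕ)))
  param₄ : ParametrisesSubgroup x₄ (Γ.rootGroup fun k => v (4 + (k : ℕ)))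
  param₅ : ParametrisesSubgroup x₅ (Γ.rootGroup fun k => v (5 + (k : ℕ)))
  param₆ : ParametrisesSubgroup x₆ (Γ.rootGroup fun k => v (6 + (k : ℕ)))
  comm₁₃ : ∀ a b, rootCommutator (x₁ a) (x₃ b) = x₂ (H.T a b)
  comm₃₅ : ∀ a b, rootCommutator (x₃ a) (x₅ b) = x₄ (H.T a b)
  comm₁₅ : ∀ a b, rootCommutator (x₁ a) (x₅ b) =
    x₂ (-H.T (H.sharp a) b) * x₃ (H.cross a b) * x₄ (H.T a (H.sharp b))
  comm₂₆ : ∀ t u, rootCommutator (x₂ t) (x₆ u) = x₄ (t * u)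
  comm₁₆ : ∀ a t, rootCommutator (x₁ a) (x₆ t) =
    x₂ (-(t * H.N a)) * x₃ (t • H.sharp a) * x₄ (t ^ 2 * H.N a) * x₅ (-(t • a))
  comm₁₂ : ∀ a t, rootCommutator (x₁ a) (x₂ t) = 1
  comm₁₄ : ∀ a t, rootCommutator (x₁ a) (x₄ t) = 1
  comm₂₃ : ∀ t a, rootCommutator (x₂ t) (x₃ a) = 1
  comm₂₄ : ∀ t u, rootCommutator (x₂ t) (x₄ u) = 1
  comm₂₅ : ∀ t a, rootCommutator (x₂ t) (x₅ a) = 1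
  comm₃₄ : ∀ a t, rootCommutator (x₃ a) (x₄ t) = 1
  comm₃₆ : ∀ a t, rootCommutator (x₃ a) (x₆ t) = 1
  comm₄₅ : ∀ t a, rootCommutator (x₄ t) (x₅ a) = 1
  comm₄₆ : ∀ t u, rootCommutator (x₄ t) (x₆ u) = 1
  comm₅₆ : ∀ a t, rootCommutator (x₅ a) (x₆ t) = 1

/-- The labels of the points: `(∞)` and the tuples of length at most five. -/
inductive PointLabel (F J : Type*) where
  | infty : PointLabel F J
  | one (t : F) : PointLabel F J
  | two (b : J) (u : F) : PointLabel F J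
  | three (t : F) (a : J) (t' : F) : PointLabel F J
  | four (b : J) (u : F) (b' : J) (u' : F) : PointLabel F J
  | five (t : F) (a : J) (t' : F) (a' : J) (t'' : F) : PointLabel F J

/-- The labels of the lines: `[∞]` and the tuples of length at most five. -/
inductive LineLabel (F J : Type*) where
  | infty : LineLabel F J
  | one (b : J) : LineLabel F J
  | two (t : F) (a : J) : LineLabel F J
  | three (b : J) (u : F) (b' : J) : LineLabel F J
  | four (t : F) (a : J) (t' : F) (a' : J) : LineLabel F J
  | five (b : J) (u : F) (b' : J) (u' : F) (b'' : J) : LineLabel F J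

/-- The links of the chain
`(t,a,t',a',t'') * [t,a,t',a'] * (t,a,t') * [t,a] * (t) * [∞] *`
`(∞) * [b] * (b,u) * [b,u,b'] * (b,u,b',u') * [b,u,b',u',b'']`. -/
inductive ChainIncident {F J : Type*} : PointLabel F J → LineLabel F J → Prop
  | five_four (t : F) (a : J) (t' : F) (a' : J) (t'' : F) :
      ChainIncident (.five t a t' a' t'') (.four t a t' a')
  | three_four (t : F) (a : J) (t' : F) (a' : J) :
      ChainIncident (.three t a t') (.four t a t' a')
  | three_two (t : F) (a : J) (t' : F) : ChainIncident (.three t a t') (.two t a)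
  | one_two (t : F) (a : J) : ChainIncident (.one t) (.two t a)
  | one_infty (t : F) : ChainIncident (.one t) .infty
  | infty_infty : ChainIncident .infty .infty
  | infty_one (b : J) : ChainIncident .infty (.one b)
  | two_one (b : J) (u : F) : ChainIncident (.two b u) (.one b)
  | two_three (b : J) (u : F) (b' : J) : ChainIncident (.two b u) (.three b u b')
  | four_three (b : J) (u : F) (b' : J) (u' : F) :
      ChainIncident (.four b u b' u') (.three b u b')
  | four_five (b : J) (u : F) (b' : J) (u' : F) (b'' : J) :
      ChainIncident (.four b u b' u') (.five b u b' u' b'')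

/-- The point label is a 5-tuple. -/
def PointLabel.IsGeneric {F J : Type*} : PointLabel F J → Prop
  | .five _ _ _ _ _ => True
  | _ => False

/-- The line label is a 5-tuple. -/
def LineLabel.IsGeneric {F J : Type*} : LineLabel F J → Prop
  | .five _ _ _ _ _ => True
  | _ => False

namespace HexagonLabelling

open PointLineGeometry

variable {P L F J : Type*} [Field F] [AddCommGroup J] [Module F J]
  {Γ : PointLineGeometry P L} {H : HexagonalSystem F J} (D : HexagonLabelling Γ H)

/-- `s₁` is a collineation that stabilises the base apartment and induces on it the reflection
fixing `p₀ = v 7` (and moving `L₀`). -/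
def RepresentsS₁ (s₁ : Γ.Collineation) : Prop := ∀ j, Collineation.act s₁ (D.v j) = D.v (14 - j)

/-- `s₆` is a collineation that stabilises the base apartment and induces on it the reflection
fixing `L₀ = v 6` (and moving `p₀`). -/
def RepresentsS₆ (s₆ : Γ.Collineation) : Prop := ∀ j, Collineation.act s₆ (D.v j) = D.v (12 - j)

/-- The point with a given label. The coset `g P₁` is the point `g p₀`, where `P₁` is the
stabiliser of `p₀`. -/
def point (s₁ s₆ : Γ.Collineation) : PointLabel F J → P
  | .infty => D.p₀
  | .one t => Collineation.onPoint (D.x₆ t * s₆) D.p₀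
  | .two b u => Collineation.onPoint (D.x₁ b * D.x₂ u * s₁ * s₆) D.p₀
  | .three t a t' => Collineation.onPoint (D.x₆ t * D.x₅ a * D.x₄ t' * s₆ * s₁ * s₆) D.p₀
  | .four b u b' u' =>
      Collineation.onPoint
        (D.x₁ b * D.x₂ u * D.x₃ b' * D.x₄ u' * s₁ * s₆ * s₁ * s₆) D.p₀
  | .five t a t' a' t'' =>
      Collineation.onPoint
        (D.x₆ t * D.x₅ a * D.x₄ t' * D.x₃ a' * D.x₂ t'' * s₆ * s₁ * s₆ * s₁ * s₆) D.p₀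

/-- The line with a given label. The coset `g P₆` is the line `g L₀`, where `P₆` is the
stabiliser of `L₀`. -/
def line (s₁ s₆ : Γ.Collineation) : LineLabel F J → L
  | .infty => D.L₀
  | .one b => Collineation.onLine (D.x₁ b * s₁) D.L₀
  | .two t a => Collineation.onLine (D.x₆ t * D.x₅ a * s₆ * s₁) D.L₀
  | .three b u b' => Collineation.onLine (D.x₁ b * D.x₂ u * D.x₃ b' * s₁ * s₆ * s₁) D.L₀
  | .four t a t' a' =>
      Collineation.onLine
        (D.x₆ t * D.x₅ a * D.x₄ t' * D.x₃ a' * s₆ * s₁ * s₆ * s₁) D.L₀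
  | .five b u b' u' b'' =>
      Collineation.onLine
        (D.x₁ b * D.x₂ u * D.x₃ b' * D.x₄ u' * D.x₅ b'' * s₁ * s₆ * s₁ * s₆ * s₁) D.L₀

end HexagonLabelling

/-!
In a generalised hexagon, a path of length at most five is determined by its end points. Each
element is therefore reached by a unique path of minimal length that passes through `p₀` and `L₀`
first, in one of the two orders. By the Moufang condition, the root group `Uᵢ` acts regularly on the
elements incident with `v (i + 6)` other than `v (i + 5)`. Hence the path is the image of an initial
part of the apartment under exactly one product `g₁ ⋯ gₙ` with `gᵢ ∈ Uᵢ` and `n ≤ 5`, or, for the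
other order, with `gᵢ ∈ U₇₋ᵢ`. These products are the labels. Unless both labels are 5-tuples, two
incident elements neither of whose paths extends the other would close a circuit of length less
than twelve; this gives the chain of incidences.

The lines through a point labelled by a 5-tuple, except the line before it on its path, form one
orbit under a conjugate of `U₁`. Moving `x₁ b` to the front of
`x₆ t * x₅ a * x₄ t' * x₃ a' * x₂ t'' * x₁ b` by means of the commutator relations yields the labels
of these lines.
-/

/-! ### Paths in a generalised hexagon -/

namespace PointLineGeometry

variable {P L : Type*} {Γ : PointLineGeometry P L}

theorem Adj.symm {x y : P ⊕ L} (h : Γ.Adj x y) : Γ.Adj y x := by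
  cases x <;> cases y <;> exact h

theorem Adj.isLeft_eq {x y : P ⊕ L} (h : Γ.Adj x y) : y.isLeft = !x.isLeft := by
  cases x <;> cases y <;> first | rfl | exact h.elim

/-- The action of the collineations on the elements (points and lines) of the geometry. -/
instance elementAction : MulAction Γ.Collineation (P ⊕ L) where
  smul g x := Collineation.act g x
  one_smul x := by cases x <;> rfl
  mul_smul g h x := by cases x <;> rfl

theorem adj_smul_iff (g : Γ.Collineation) {x y : P ⊕ L} : Γ.Adj (g • x) (g • y) ↔ Γ.Adj x y := by
  cases x <;> cases y
  · exact Iff.rfl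
  · exact g.2 _ _
  · exact g.2 _ _
  · exact Iff.rfl

theorem Collineation.eq_one_of_forall_smul_eq {g : Γ.Collineation}
    (h : ∀ x : P ⊕ L, g • x = x) : g = 1 := by
  apply Subtype.ext
  apply Prod.ext
  · ext p
    exact Sum.inl_injective (h (Sum.inl p))
  · ext l
    exact Sum.inr_injective (h (Sum.inr l))

variable (Γ) in
/-- The elements `γ 0, …, γ n` form a path of length `n` without backtracking. The path is encoded
as an infinite sequence whose values after `γ n` are irrelevant. -/
structure IsPath (n : ℕ) (γ : ℕ → P ⊕ L) : Prop where
  adj : ∀ i < n, Γ.Adj (γ i) (γ (i + 1))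
  ne : ∀ i, i + 2 ≤ n → γ i ≠ γ (i + 2)

namespace IsPath

variable {n : ℕ} {γ : ℕ → P ⊕ L}

theorem mono (h : Γ.IsPath n γ) {m : ℕ} (hm : m ≤ n) : Γ.IsPath m γ :=
  ⟨fun i hi => h.adj i (by omega), fun i hi => h.ne i (by omega)⟩

theorem shift (h : Γ.IsPath n γ) (k : ℕ) {m : ℕ} (hm : k + m ≤ n) :
    Γ.IsPath m fun i => γ (k + i) :=
  ⟨fun i hi => h.adj (k + i) (by omega), fun i hi => h.ne (k + i) (by omega)⟩

theorem reverse (h : Γ.IsPath n γ) : Γ.IsPath n fun i => γ (n - i) := by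
  refine ⟨fun i hi => ?_, fun i hi => ?_⟩
  · have := (h.adj (n - (i + 1)) (by omega)).symm
    rwa [show n - (i + 1) + 1 = n - i by omega] at this
  · have := (h.ne (n - (i + 2)) (by omega)).symm
    rwa [show n - (i + 2) + 2 = n - i by omega] at this

theorem smul (h : Γ.IsPath n γ) (g : Γ.Collineation) : Γ.IsPath n fun i => g • γ i :=
  ⟨fun i hi => (adj_smul_iff g).2 (h.adj i hi), fun i hi he => h.ne i hi (smul_left_cancel g he)⟩

theorem append {m : ℕ} {δ : ℕ → P ⊕ L} (h : Γ.IsPath m γ) (h' : Γ.IsPath n δ) (e : γ m = δ 0)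
    (hne : 0 < m → 0 < n → γ (m - 1) ≠ δ 1) :
    Γ.IsPath (m + n) fun i => if i ≤ m then γ i else δ (i - m) := by
  refine ⟨fun i hi => ?_, fun i hi => ?_⟩
  · rcases lt_trichotomy i m with hm | rfl | hm
    · simpa only [hm.le, Nat.succ_le_of_lt hm, if_true] using h.adj i hm
    · simpa [e] using h'.adj 0 (by omega)
    · have := h'.adj (i - m) (by omega)
      rw [show i - m + 1 = i + 1 - m by omega] at this
      simpa [show ¬ i ≤ m by omega, show ¬ i + 1 ≤ m by omega] using this
  · rcases lt_trichotomy (i + 1) m with hm | rfl | hm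
    · simpa [show i ≤ m by omega, show i + 2 ≤ m by omega] using h.ne i (by omega)
    · simpa [show i + 2 - (i + 1) = 1 by omega] using hne (by omega) (by omega)
    · have := h'.ne (i - m) (by omega)
      rw [show i - m + 2 = i + 2 - m by omega] at this
      rcases Nat.lt_or_ge m i with hi' | hi'
      · simpa [show ¬ i ≤ m by omega, show ¬ i + 2 ≤ m by omega] using this
      · obtain rfl : i = m := by omega
        simpa [e] using this

theorem cons (h : Γ.IsPath n γ) {x : P ⊕ L} (hx : Γ.Adj x (γ 0)) (hne : 0 < n → x ≠ γ 1) :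
    Γ.IsPath (n + 1) fun i => Nat.casesOn i x γ := by
  refine ⟨fun i hi => ?_, fun i hi => ?_⟩
  · cases i with
    | zero => exact hx
    | succ i => exact h.adj i (by omega)
  · cases i with
    | zero => exact hne (by omega)
    | succ i => exact h.ne i (by omega)

theorem isLeft_eq_iff_even (h : Γ.IsPath n γ) {i : ℕ} (hi : i ≤ n) :
    (γ i).isLeft = (γ 0).isLeft ↔ Even i := by
  induction i with
  | zero => simp only [Even.zero]
  | succ i ih =>
    rw [(h.adj i hi).isLeft_eq, Nat.even_add_one, ← ih (by omega)]
    cases (γ i).isLeft <;> cases (γ 0).isLeft <;> decide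

theorem even_iff_even (h : Γ.IsPath n γ) {m : ℕ} {δ : ℕ → P ⊕ L} (h' : Γ.IsPath m δ)
    (e₀ : γ 0 = δ 0) (e : γ n = δ m) : Even n ↔ Even m := by
  rw [← h.isLeft_eq_iff_even le_rfl, ← h'.isLeft_eq_iff_even le_rfl, e₀, e]

theorem isOrdinaryGon_of_injOn {k : ℕ} (h : Γ.IsPath (2 * k) γ) (hk : 0 < k)
    (he : γ 0 = γ (2 * k)) (hinj : Set.InjOn γ (Set.Iio (2 * k))) :
    Γ.IsOrdinaryGon k fun c : ZMod (2 * k) => γ c.val := by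
  have : NeZero (2 * k) := ⟨by omega⟩
  have : Fact (1 < 2 * k) := ⟨by omega⟩
  refine ⟨fun c d hcd => ZMod.val_injective _ (hinj (ZMod.val_lt c) (ZMod.val_lt d) hcd),
    fun c => ?_⟩
  have hadj := h.adj c.val (ZMod.val_lt c)
  have hval : (c + 1).val = (c.val + 1) % (2 * k) := by rw [ZMod.val_add, ZMod.val_one]
  rcases (Nat.succ_le_of_lt (ZMod.val_lt c)).lt_or_eq with hlt | heq
  · rw [Nat.mod_eq_of_lt hlt] at hval
    simpa only [hval] using hadj
  · rw [← Nat.succ_eq_add_one, heq, Nat.mod_self] at hval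
    simpa only [hval, he, ← heq] using hadj

theorem exists_isOrdinaryGon_of_closed (h : Γ.IsPath n γ) (h0 : 0 < n) (he : γ 0 = γ n) :
    ∃ k, 2 ≤ k ∧ 2 * k ≤ n ∧ ∃ v : ZMod (2 * k) → P ⊕ L, Γ.IsOrdinaryGon k v := by
  induction n using Nat.strong_induction_on generalizing γ with
  | _ n ih =>
  by_cases hinj : Set.InjOn γ (Set.Iio n)
  · obtain ⟨k, rfl⟩ : Even n := (h.isLeft_eq_iff_even le_rfl).1 (by rw [he])
    rw [← two_mul] at *
    have hk : k ≠ 1 := by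
      rintro rfl
      exact h.ne 0 le_rfl he
    exact ⟨k, by omega, le_rfl, _, h.isOrdinaryGon_of_injOn (by omega) he hinj⟩
  · obtain ⟨i, j, hij, hj, e⟩ : ∃ i j, i < j ∧ j < n ∧ γ i = γ j := by
      simp only [Set.InjOn, Set.mem_Iio, not_forall] at hinj
      obtain ⟨i, hi, j, hj, e, hne⟩ := hinj
      rcases Nat.lt_or_gt_of_ne hne with hlt | hlt
      · exact ⟨i, j, hlt, hj, e⟩
      · exact ⟨j, i, hlt, hi, e.symm⟩
    obtain ⟨k, hk2, hk, hv⟩ := ih (j - i) (by omega) (h.shift i (by omega)) (by omega)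
      (by simpa only [add_zero, Nat.add_sub_cancel' hij.le] using e)
    exact ⟨k, hk2, by omega, hv⟩

end IsPath

namespace IsOrdinaryGon

variable {k : ℕ} {v : ZMod (2 * k) → P ⊕ L}

theorem reflect (hv : Γ.IsOrdinaryGon k v) (c : ZMod (2 * k)) :
    Γ.IsOrdinaryGon k fun j => v (c - j) :=
  ⟨hv.1.comp sub_right_injective, fun j => by
    simpa only [← sub_sub, sub_add_cancel] using (hv.2 (c - j - 1)).symm⟩

theorem smul (hv : Γ.IsOrdinaryGon k v) (g : Γ.Collineation) :
    Γ.IsOrdinaryGon k fun j => g • v j :=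
  ⟨(MulAction.injective g).comp hv.1, fun j => (adj_smul_iff g).2 (hv.2 j)⟩

theorem adj_pred (hv : Γ.IsOrdinaryGon k v) (j : ZMod (2 * k)) : Γ.Adj (v j) (v (j - 1)) := by
  simpa only [sub_add_cancel] using (hv.2 (j - 1)).symm

theorem isPath (hv : Γ.IsOrdinaryGon k v) (hk : 2 ≤ k) (c : ZMod (2 * k)) (n : ℕ) :
    Γ.IsPath n fun i => v (c + i) := by
  refine ⟨fun i _ => ?_, fun i _ he => ?_⟩
  · simpa only [Nat.cast_succ, add_assoc] using hv.2 (c + i)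
  · have h2 : ((2 : ℕ) : ZMod (2 * k)) = 0 := by
      simpa only [Nat.cast_add, add_right_inj, left_eq_add] using hv.1 he
    have := Nat.le_of_dvd two_pos ((ZMod.natCast_eq_zero_iff 2 (2 * k)).1 h2)
    omega

theorem isRoot {v : ZMod (2 * 6) → P ⊕ L} (hv : Γ.IsOrdinaryGon 6 v) (i : ZMod (2 * 6)) :
    Γ.IsRoot fun k => v (i + (k : ℕ)) := by
  have hcast : Function.Injective fun k : Fin 7 => ((k : ℕ) : ZMod (2 * 6)) := by decide
  refine ⟨hv.1.comp ((add_right_injective i).comp hcast), fun k => ?_⟩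
  simpa only [Fin.val_castSucc, Fin.val_succ, Nat.cast_succ, add_assoc] using hv.2 (i + (k : ℕ))

end IsOrdinaryGon

variable (Γ) in
/-- Two elements at distance six in the incidence graph. -/
def Opposite (x y : P ⊕ L) : Prop := ∃ γ, Γ.IsPath 6 γ ∧ γ 0 = x ∧ γ 6 = y

theorem Opposite.symm {x y : P ⊕ L} (h : Γ.Opposite x y) : Γ.Opposite y x := by
  obtain ⟨γ, hγ, h0, h6⟩ := h
  exact ⟨_, hγ.reverse, h6, h0⟩

theorem IsOrdinaryGon.opposite {v : ZMod (2 * 6) → P ⊕ L} (hv : Γ.IsOrdinaryGon 6 v)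
    (i : ZMod (2 * 6)) : Γ.Opposite (v i) (v (i + 6)) :=
  ⟨_, hv.isPath (by decide) i 6, by rw [Nat.cast_zero, add_zero], rfl⟩

namespace IsGeneralisedHexagon

variable (hΓ : Γ.IsGeneralisedHexagon)
include hΓ

theorem path_not_closed {n : ℕ} {γ : ℕ → P ⊕ L} (h : Γ.IsPath n γ) (h0 : 0 < n) (hn : n < 12) :
    γ 0 ≠ γ n := fun he => by
  obtain ⟨k, hk2, hk, v, hv⟩ := h.exists_isOrdinaryGon_of_closed h0 he
  exact hΓ.2.1 k hk2 (by omega) v hv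

theorem path_unique {m n : ℕ} {γ δ : ℕ → P ⊕ L} (h : Γ.IsPath m γ) (h' : Γ.IsPath n δ)
    (hmn : m + n < 12) (e₀ : γ 0 = δ 0) (e : γ m = δ n) : m = n ∧ ∀ i ≤ m, γ i = δ i := by
  induction m generalizing n with
  | zero =>
    rcases Nat.eq_zero_or_pos n with rfl | hn
    · exact ⟨rfl, fun i hi => by rwa [Nat.le_zero.1 hi]⟩
    · exact (hΓ.path_not_closed h' hn (by omega) (e₀ ▸ e)).elim
  | succ m ih =>
    cases n with
    | zero => exact (hΓ.path_not_closed h (by omega) (by omega) (e₀.trans e.symm)).elim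
    | succ n =>
      by_cases hl : γ m = δ n
      · obtain ⟨rfl, hi⟩ := ih (h.mono (by omega)) (h'.mono (by omega)) (by omega) hl
        refine ⟨rfl, fun i hi' => ?_⟩
        rcases Nat.le_or_eq_of_le_succ hi' with hm | rfl
        exacts [hi i hm, e]
      · have hclosed := h.append h'.reverse (by simpa only [Nat.sub_zero] using e)
          (fun _ _ => by simpa only [Nat.add_sub_cancel] using hl)
        refine (hΓ.path_not_closed hclosed (by omega) (by omega) ?_).elim
        simpa [show ¬ m + 1 + (n + 1) ≤ m + 1 by omega] using e₀

theorem penultimate_eq_of_adj {m n : ℕ} {γ δ : ℕ → P ⊕ L} (h : Γ.IsPath m γ) (h' : Γ.IsPath n δ)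
    (hmn : m + n ≤ 10) (e₀ : γ 0 = δ 0) (hadj : Γ.Adj (γ m) (δ n)) :
    (0 < m ∧ γ (m - 1) = δ n) ∨ (0 < n ∧ δ (n - 1) = γ m) := by
  by_contra! hcon
  have hclosed := h.append (h'.reverse.cons hadj fun hn => (hcon.2 hn).symm) rfl
    fun hm _ => hcon.1 hm
  refine hΓ.path_not_closed hclosed (by omega) (by omega) ?_
  simpa [show ¬ m + (n + 1) ≤ m by omega] using e₀

theorem path_end_ne {m n : ℕ} {γ δ : ℕ → P ⊕ L} (h : Γ.IsPath m γ) (h' : Γ.IsPath n δ)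
    (hm0 : 0 < m) (hn0 : 0 < n) (hm : m ≤ 6) (hn : n ≤ 6) (e₀ : γ 0 = δ 1) (e₁ : γ 1 = δ 0) :
    γ m ≠ δ n := fun e => by
  obtain ⟨hlen, heq⟩ := hΓ.path_unique h' (h.shift 1 (m := m - 1) (by omega)) (by omega) e₁.symm
    (by rw [Nat.add_sub_cancel' hm0, e])
  exact h.ne 0 (by omega) (e₀.trans (heq 1 hn0))

theorem exists_path (x y : P ⊕ L) : ∃ n ≤ 6, ∃ γ, Γ.IsPath n γ ∧ γ 0 = x ∧ γ n = y := by
  obtain ⟨v, hv, ⟨i, rfl⟩, ⟨j, rfl⟩⟩ := hΓ.2.2 x y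
  rcases Nat.le_total (j - i).val 6 with h | h
  · exact ⟨_, h, _, hv.isPath (by decide) i _, by simp, by simp⟩
  · have hlt : (j - i).val < 12 := ZMod.val_lt (j - i)
    refine ⟨12 - (j - i).val, by omega, _,
      ((hv.isPath (by decide) j _).reverse), ?_, by simp⟩
    rw [Nat.sub_zero, Nat.cast_sub hlt.le, ZMod.natCast_zmod_val]
    congr 1
    rw [show ((12 : ℕ) : ZMod (2 * 6)) = 0 by decide]
    ring

theorem exists_path_through {x y z : P ⊕ L} (h : Γ.Opposite x y) (hz : Γ.Adj x z) :
    ∃ γ, Γ.IsPath 6 γ ∧ γ 0 = x ∧ γ 1 = z ∧ γ 6 = y := by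
  obtain ⟨δ, hδ, rfl, rfl⟩ := h
  obtain ⟨n, hn, γ, hγ, rfl, he⟩ := hΓ.exists_path z (δ 6)
  by_cases h1 : 0 < n ∧ δ 0 = γ 1
  · obtain ⟨hn0, h1⟩ := h1
    have := hΓ.path_unique (hγ.shift 1 (m := n - 1) (by omega)) hδ (by omega) h1.symm
      (by rwa [Nat.add_sub_cancel' hn0])
    omega
  · have hp := hγ.cons hz fun hn0 e => h1 ⟨hn0, e⟩
    obtain rfl : n = 5 := by
      by_contra hne
      have hpar := hp.even_iff_even hδ rfl he
      have hn6 : n ≠ 6 := by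
        rintro rfl
        exact absurd hpar (by decide)
      have := hΓ.path_unique hp hδ (by omega) rfl he
      omega
    exact ⟨_, hp, rfl, rfl, he⟩

theorem exists_path_from {x z : P ⊕ L} (hxz : Γ.Adj x z) (y : P ⊕ L) :
    ∃ n ≤ 5, ∃ γ, Γ.IsPath (n + 1) γ ∧ γ (n + 1) = y ∧
      (γ 0 = x ∧ γ 1 = z ∨ γ 0 = z ∧ γ 1 = x) := by
  obtain ⟨n, hn, γ, hγ, rfl, rfl⟩ := hΓ.exists_path x y
  by_cases h1 : 0 < n ∧ z = γ 1
  · obtain ⟨hn0, rfl⟩ := h1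
    obtain ⟨n, rfl⟩ := Nat.exists_eq_add_of_lt hn0
    exact ⟨n, by omega, γ, by simpa only [Nat.zero_add] using hγ, by rw [Nat.zero_add],
      Or.inl ⟨rfl, rfl⟩⟩
  rcases hn.lt_or_eq with hn6 | rfl
  · exact ⟨n, by omega, _, hγ.cons hxz.symm fun hn0 e => h1 ⟨hn0, e⟩, rfl, Or.inr ⟨rfl, rfl⟩⟩
  · obtain ⟨δ, hδ, h0, h1, h6⟩ := hΓ.exists_path_through ⟨γ, hγ, rfl, rfl⟩ hxz
    exact ⟨5, le_rfl, δ, hδ, h6, Or.inl ⟨h0, h1⟩⟩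

end IsGeneralisedHexagon

/-! ### Root groups of an apartment -/

theorem IsThick.three_le_encard_neighbours (hΓ : Γ.IsThick) (x : P ⊕ L) :
    3 ≤ {y | Γ.Adj x y}.encard := by
  cases x with
  | inl p =>
    refine (hΓ.2 p).trans ?_
    rw [← Sum.inr_injective.encard_image (α := L) (β := P ⊕ L)]
    exact Set.encard_le_encard (Set.image_subset_iff.2 fun _ h => h)
  | inr l =>
    refine (hΓ.1 l).trans ?_
    rw [← Sum.inl_injective.encard_image (α := P) (β := P ⊕ L)]
    exact Set.encard_le_encard (Set.image_subset_iff.2 fun _ h => h)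

theorem IsThick.exists_third (hΓ : Γ.IsThick) (x y z : P ⊕ L) :
    ∃ u, Γ.Adj x u ∧ u ≠ y ∧ u ≠ z := by
  have hlt : ({y, z} : Set (P ⊕ L)).encard < {u | Γ.Adj x u}.encard := by
    refine (Set.encard_insert_le {z} y).trans_lt ?_
    rw [Set.encard_singleton]
    exact lt_of_lt_of_le (by decide) (hΓ.three_le_encard_neighbours x)
  obtain ⟨u, hu, hne⟩ := Set.not_subset.1 fun hsub => (Set.encard_le_encard hsub).not_gt hlt
  rw [Set.mem_insert_iff, Set.mem_singleton_iff, not_or] at hne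
  exact ⟨u, hu, hne⟩

/-- The collineation `g` fixes every element incident with `x`. -/
def FixesNeighbours (g : Γ.Collineation) (x : P ⊕ L) : Prop := ∀ y, Γ.Adj x y → g • y = y

section Rigidity

variable (hΓ : Γ.IsGeneralisedHexagon) (hT : Γ.IsThick)
include hΓ

theorem FixesNeighbours.of_opposite {g : Γ.Collineation} {x w : P ⊕ L} (h : FixesNeighbours g x)
    (hw : g • w = w) (ho : Γ.Opposite x w) : FixesNeighbours g w := by
  intro z hz
  obtain ⟨γ, hγ, rfl, rfl, rfl⟩ := hΓ.exists_path_through ho.symm hz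
  have h5 : g • γ 5 = γ 5 := h _ (hγ.adj 5 (by omega)).symm
  have hγ' := hγ.mono (m := 5) (by omega)
  exact (hΓ.path_unique (hγ'.smul g) hγ' (by omega) hw h5).2 1 (by omega)

include hT in
theorem FixesNeighbours.propagate {g : Γ.Collineation} {x y z w : P ⊕ L} (hxy : Γ.Adj x y)
    (hx : FixesNeighbours g x) (hy : FixesNeighbours g y) (hw : g • w = w) (ho : Γ.Opposite y w)
    (hz : Γ.Adj y z) : FixesNeighbours g z ∧ ∃ w', g • w' = w' ∧ Γ.Opposite z w' := by
  -- The path from `y` to `w` through `u` ends next to `w` in an element opposite both `x` and `z`.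
  obtain ⟨u, hu, hux, huz⟩ := hT.exists_third y x z
  obtain ⟨γ, hγ, rfl, rfl, rfl⟩ := hΓ.exists_path_through ho hu
  have hγ' := hγ.shift 1 (m := 5) (by omega)
  have hfix : g • γ 5 = γ 5 :=
    (hΓ.path_unique (hγ'.smul g) hγ' (by omega) (hy _ hu) hw).2 4 (by omega)
  have hop : ∀ {t}, Γ.Adj (γ 0) t → γ 1 ≠ t → Γ.Opposite t (γ 5) := fun {t} ht hne =>
    ⟨_, (hγ.mono (m := 5) (by omega)).cons ht.symm fun _ => hne.symm, rfl, rfl⟩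
  have h5 := hx.of_opposite hΓ hfix (hop hxy.symm hux)
  exact ⟨h5.of_opposite hΓ (hy _ hz) (hop hz huz).symm, _, hfix, hop hz huz⟩

include hT in
theorem eq_one_of_fixesNeighbours {g : Γ.Collineation} {x y w : P ⊕ L} (hxy : Γ.Adj x y)
    (hx : FixesNeighbours g x) (hy : FixesNeighbours g y) (hw : g • w = w)
    (ho : Γ.Opposite y w) : g = 1 := by
  refine Collineation.eq_one_of_forall_smul_eq fun e => ?_
  obtain ⟨n, -, γ, hγ, rfl, rfl⟩ := hΓ.exists_path y e
  have along_path : ∀ k ≤ n, g • γ k = γ k ∧ FixesNeighbours g (γ k) ∧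
      (∃ x, Γ.Adj x (γ k) ∧ FixesNeighbours g x) ∧ ∃ w, g • w = w ∧ Γ.Opposite (γ k) w := by
    intro k
    induction k with
    | zero => exact fun _ => ⟨hx _ hxy, hy, ⟨x, hxy, hx⟩, w, hw, ho⟩
    | succ k ih =>
      intro hk
      obtain ⟨-, hy', ⟨x', hxy', hx'⟩, w', hw', ho'⟩ := ih (by omega)
      have hadj := hγ.adj k (by omega)
      obtain ⟨hz, hex⟩ := hx'.propagate hΓ hT hxy' hy' hw' ho' hadj
      exact ⟨hy' _ hadj, hz, ⟨_, hadj, hy'⟩, hex⟩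
  exact (along_path n le_rfl).1

end Rigidity

theorem rootGroup_rev (γ : Fin 7 → P ⊕ L) : Γ.rootGroup (fun k => γ k.rev) = Γ.rootGroup γ := by
  have hle : ∀ γ : Fin 7 → P ⊕ L, Γ.rootGroup γ ≤ Γ.rootGroup (fun k => γ k.rev) :=
    fun γ g hg i h0 h6 => hg i.rev (by revert i; decide) (by revert i; decide)
  refine le_antisymm ?_ (hle γ)
  simpa only [Fin.rev_rev] using hle fun k => γ k.rev

variable (Γ) in
/-- The root group `U_i` of the apartment `v`, that is, of the path `v i, …, v (i + 6)`. -/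
abbrev apartmentRootGroup (v : ZMod (2 * 6) → P ⊕ L) (i : ZMod (2 * 6)) :
    Subgroup Γ.Collineation :=
  Γ.rootGroup fun k => v (i + (k : ℕ))

theorem apartmentRootGroup_reflect (v : ZMod (2 * 6) → P ⊕ L) (c i : ZMod (2 * 6)) :
    Γ.apartmentRootGroup (fun j => v (c - j)) i = Γ.apartmentRootGroup v (c - i - 6) := by
  rw [apartmentRootGroup, ← rootGroup_rev]
  have hrev : ∀ k : Fin 7, ((k.rev : ℕ) : ZMod (2 * 6)) = 6 - (k : ℕ) := by decide
  congr 1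
  funext k
  rw [hrev]
  ring_nf

section Apartment

variable {v : ZMod (2 * 6) → P ⊕ L} (hv : Γ.IsOrdinaryGon 6 v) {i : ZMod (2 * 6)}
  {g h : Γ.Collineation}
include hv

theorem smul_eq_of_mem_apartmentRootGroup (hg : g ∈ Γ.apartmentRootGroup v i) {j : ℕ}
    (hj : j ≤ 6) : g • v (i + j) = v (i + j) := by
  have hr := (hv.isRoot i).2
  interval_cases j
  exacts [hg 1 (by decide) (by decide) _ (hr 0).symm,
    hg 2 (by decide) (by decide) _ (hr 1).symm,
    hg 1 (by decide) (by decide) _ (hr 1),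
    hg 2 (by decide) (by decide) _ (hr 2),
    hg 3 (by decide) (by decide) _ (hr 3),
    hg 4 (by decide) (by decide) _ (hr 4),
    hg 5 (by decide) (by decide) _ (hr 5)]

theorem IsMoufangHexagon.exists_smul_pred_eq (hΓ : Γ.IsMoufangHexagon) {y : P ⊕ L}
    (hy : Γ.Adj (v i) y) (hne : y ≠ v (i + 1)) :
    ∃ g ∈ Γ.apartmentRootGroup v i, g • v (i - 1) = y := by
  have h0 : v (i + ((0 : Fin 7) : ℕ)) = v i := congrArg v (add_zero i)
  have h1 : v (i + ((1 : Fin 7) : ℕ)) = v (i + 1) := congrArg v (by norm_num)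
  refine hΓ.2.2 _ (hv.isRoot i) (v (i - 1)) y ?_ ?_ ?_ ?_
  · rw [h0]
    exact hv.adj_pred i
  · rw [h1]
    refine hv.1.ne fun e => ?_
    rw [sub_eq_add_neg, add_right_inj] at e
    exact absurd e (by decide)
  · rwa [h0]
  · rwa [h1]

theorem IsMoufangHexagon.adj_smul_iff_exists (hΓ : Γ.IsMoufangHexagon) {y : P ⊕ L} :
    Γ.Adj (g • v i) y ↔
      y = g • v (i + 1) ∨ ∃ h ∈ Γ.apartmentRootGroup v i, y = (g * h) • v (i - 1) := by
  constructor
  · intro hy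
    rw [← smul_inv_smul g y, adj_smul_iff] at hy
    refine or_iff_not_imp_left.2 fun hne => ?_
    obtain ⟨h, hh, e⟩ := hΓ.exists_smul_pred_eq hv hy fun e => hne (inv_smul_eq_iff.1 e)
    exact ⟨h, hh, by rw [mul_smul, e, smul_inv_smul]⟩
  · rintro (rfl | ⟨h, hh, rfl⟩)
    · exact (adj_smul_iff g).2 (hv.2 i)
    · have hfix : h • v i = v i := by
        simpa only [Nat.cast_zero, add_zero] using
          smul_eq_of_mem_apartmentRootGroup hv hh (j := 0) (Nat.zero_le 6)
      have hadj := (adj_smul_iff h).2 (hv.adj_pred i)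
      rw [hfix] at hadj
      rwa [mul_smul, adj_smul_iff]

theorem IsMoufangHexagon.exists_smul_succ_eq (hΓ : Γ.IsMoufangHexagon) {y : P ⊕ L}
    (hy : Γ.Adj (v (i + 6)) y) (hne : y ≠ v (i + 5)) :
    ∃ g ∈ Γ.apartmentRootGroup v i, g • v (i + 7) = y := by
  have h := hΓ.exists_smul_pred_eq (hv.reflect (i + 6)) (i := 0) (y := y)
    (by rwa [sub_zero]) (by rwa [show i + 6 - (0 + 1) = i + 5 by ring])
  rwa [apartmentRootGroup_reflect, show i + 6 - 0 - 6 = i by ring,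
    show i + 6 - (0 - 1) = i + 7 by ring] at h

theorem IsMoufangHexagon.eq_of_smul_succ_eq (hΓ : Γ.IsMoufangHexagon)
    (hg : g ∈ Γ.apartmentRootGroup v i) (hh : h ∈ Γ.apartmentRootGroup v i)
    (e : g • v (i + 7) = h • v (i + 7)) : g = h := by
  have hmem : h⁻¹ * g ∈ Γ.apartmentRootGroup v i := mul_mem (inv_mem hh) hg
  have hfix : (h⁻¹ * g) • v (i + 7) = v (i + 7) := by rw [mul_smul, e, inv_smul_smul]
  have ho : Γ.Opposite (v (i + 1)) (v (i + 7)) := by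
    have := hv.opposite (i + 1)
    rwa [add_assoc, show (1 + 6 : ZMod (2 * 6)) = 7 by decide] at this
  have hone : h⁻¹ * g = 1 := eq_one_of_fixesNeighbours hΓ.1 hΓ.2.1 ((hv.isRoot i).2 1).symm
    (hmem 2 (by decide) (by decide)) (hmem 1 (by decide) (by decide)) hfix
    (by convert ho using 3; norm_num)
  exact (inv_mul_eq_one.1 hone).symm

end Apartment

end PointLineGeometry

/-! ### Reflections of an apartment -/

theorem exists_mem_sup_swap {G α : Type*} [Group G] [MulAction G α] {S : Set α} {U V : Subgroup G}
    {a b c : α} (hUS : ∀ g ∈ U, ∀ y ∈ S, g • y ∈ S) (hVb : ∀ g ∈ V, g • b = b)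
    (hU : ∀ y ∈ S, y ≠ a → ∃ g ∈ U, g • b = y) (hV : ∀ y ∈ S, y ≠ b → ∃ g ∈ V, g • a = y)
    (hb : b ∈ S) (hc : c ∈ S) (hca : c ≠ a) (hcb : c ≠ b) :
    ∃ s ∈ U ⊔ V, s • a = b ∧ s • b = a := by
  obtain ⟨g, hg, rfl⟩ := hU c hc hca
  obtain ⟨h, hh, hha⟩ := hV (g⁻¹ • b) (hUS _ (inv_mem hg) b hb)
    fun e => hcb (inv_smul_eq_iff.1 e).symm
  obtain ⟨h', hh', hha'⟩ := hV (g • b) hc hcb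
  refine ⟨h'⁻¹ * g * h, mul_mem (mul_mem (inv_mem ?_) ?_) ?_, ?_, ?_⟩
  · exact Subgroup.mem_sup_right hh'
  · exact Subgroup.mem_sup_left hg
  · exact Subgroup.mem_sup_right hh
  · rw [mul_smul, mul_smul, hha, smul_inv_smul, hVb _ (inv_mem hh')]
  · rw [mul_smul, mul_smul, hVb h hh, inv_smul_eq_iff, hha']

namespace PointLineGeometry

variable {P L : Type*} {Γ : PointLineGeometry P L}

theorem IsGeneralisedHexagon.eq_on_half_gon (hΓ : Γ.IsGeneralisedHexagon)
    {v w : ZMod (2 * 6) → P ⊕ L} (hv : Γ.IsOrdinaryGon 6 v) (hw : Γ.IsOrdinaryGon 6 w)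
    {i : ZMod (2 * 6)} (h₀ : v i = w i) (h₅ : v (i + 5) = w (i + 5)) {k : ℕ} (hk : k ≤ 5) :
    v (i + k) = w (i + k) :=
  (hΓ.path_unique (hv.isPath (by decide) i 5) (hw.isPath (by decide) i 5) (by decide)
    (by simpa only [Nat.cast_zero, add_zero] using h₀) h₅).2 k hk

theorem IsGeneralisedHexagon.gon_ext (hΓ : Γ.IsGeneralisedHexagon)
    {v w : ZMod (2 * 6) → P ⊕ L} (hv : Γ.IsOrdinaryGon 6 v) (hw : Γ.IsOrdinaryGon 6 w)
    (i : ZMod (2 * 6)) (h₀ : v i = w i) (h₁ : v (i + 1) = w (i + 1)) (h₆ : v (i + 6) = w (i + 6))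
    (h₁' : v (i - 1) = w (i - 1)) : v = w := by
  have e₆ : ∀ i : ZMod (2 * 6), i + 6 = i + 1 + 5 := by decide
  have e₁₁ : ∀ i : ZMod (2 * 6), i - 1 = i + 6 + 5 := by decide
  rw [e₁₁] at h₁'
  funext j
  have hj : j = i + ((j - i).val : ℕ) := by rw [ZMod.natCast_zmod_val, add_sub_cancel]
  have hlt : (j - i).val < 12 := ZMod.val_lt _
  generalize (j - i).val = k at hj hlt
  subst hj
  obtain rfl | ⟨h1, h6⟩ | h7 : k = 0 ∨ (1 ≤ k ∧ k ≤ 6) ∨ 6 ≤ k := by omega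
  · simpa only [Nat.cast_zero, add_zero] using h₀
  · obtain ⟨k, rfl⟩ := Nat.exists_eq_add_of_le h1
    have := hΓ.eq_on_half_gon hv hw h₁ (e₆ i ▸ h₆) (k := k) (by omega)
    rwa [Nat.cast_add, Nat.cast_one, ← add_assoc]
  · obtain ⟨k, rfl⟩ := Nat.exists_eq_add_of_le h7
    have := hΓ.eq_on_half_gon hv hw h₆ h₁' (k := k) (by omega)
    rwa [Nat.cast_add, ← add_assoc]

theorem IsMoufangHexagon.exists_swap_neighbours (hΓ : Γ.IsMoufangHexagon)
    {v : ZMod (2 * 6) → P ⊕ L} (hv : Γ.IsOrdinaryGon 6 v) (i : ZMod (2 * 6)) :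
    ∃ s : Γ.Collineation, s • v i = v i ∧ s • v (i + 6) = v (i + 6) ∧
      s • v (i + 1) = v (i - 1) ∧ s • v (i - 1) = v (i + 1) := by
  have e₁₂ : i + 6 + 6 = i := by decide +revert
  have e₁₁ : i + 6 + 5 = i - 1 := by decide +revert
  have e₁₃ : i + 6 + 7 = i + 1 := by decide +revert
  set U := Γ.apartmentRootGroup v i
  set V := Γ.apartmentRootGroup v (i + 6)
  have hU : ∀ g ∈ U, g • v i = v i ∧ g • v (i + 6) = v (i + 6) := fun g hg =>
    ⟨by simpa only [Nat.cast_zero, add_zero] using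
        smul_eq_of_mem_apartmentRootGroup hv hg (j := 0) (by decide),
      smul_eq_of_mem_apartmentRootGroup hv hg (j := 6) le_rfl⟩
  have hV : ∀ g ∈ V, g • v i = v i ∧ g • v (i + 6) = v (i + 6) ∧ g • v (i - 1) = v (i - 1) :=
    fun g hg => by
      have hfix := fun j => smul_eq_of_mem_apartmentRootGroup hv hg (j := j)
      have h0 := hfix 0 (by decide)
      have h5 := hfix 5 (by decide)
      have h6 := hfix 6 le_rfl
      rw [Nat.cast_zero, add_zero] at h0
      rw [Nat.cast_ofNat] at h5 h6
      exact ⟨e₁₂ ▸ h6, h0, e₁₁ ▸ h5⟩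
  obtain ⟨c, hc, hca, hcb⟩ := hΓ.2.1.exists_third (v i) (v (i + 1)) (v (i - 1))
  obtain ⟨s, hs, hsa, hsb⟩ := exists_mem_sup_swap (S := {y | Γ.Adj (v i) y}) (U := U) (V := V)
    (fun g hg y hy => by
      have := (adj_smul_iff g).2 hy
      rwa [(hU g hg).1] at this)
    (fun g hg => (hV g hg).2.2) (fun y hy hne => hΓ.exists_smul_pred_eq hv hy hne)
    (fun y hy hne => by
      have := hΓ.exists_smul_succ_eq hv (i := i + 6) (y := y) (by rwa [e₁₂]) (by rwa [e₁₁])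
      rwa [e₁₃] at this)
    (hv.adj_pred i) hc hca hcb
  have hle : U ⊔ V ≤ MulAction.stabilizer _ (v i) ⊓ MulAction.stabilizer _ (v (i + 6)) :=
    sup_le (fun g hg => hU g hg) fun g hg => ⟨(hV g hg).1, (hV g hg).2.1⟩
  exact ⟨s, (hle hs).1, (hle hs).2, hsa, hsb⟩

theorem IsMoufangHexagon.exists_reflection (hΓ : Γ.IsMoufangHexagon) {v : ZMod (2 * 6) → P ⊕ L}
    (hv : Γ.IsOrdinaryGon 6 v) (i : ZMod (2 * 6)) :
    ∃ s : Γ.Collineation, ∀ j, s • v j = v (i + i - j) := by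
  obtain ⟨s, hs0, hs6, hsa, hsb⟩ := hΓ.exists_swap_neighbours hv i
  have e₆ : ∀ i : ZMod (2 * 6), i + i - (i + 6) = i + 6 := by decide
  refine ⟨s, congrFun (hΓ.1.gon_ext (hv.smul s) (hv.reflect (i + i)) i ?_ ?_ ?_ ?_)⟩
  · rwa [add_sub_cancel_right]
  · rwa [show i + i - (i + 1) = i - 1 by ring]
  · rwa [e₆]
  · rwa [show i + i - (i - 1) = i + 1 by ring]

/-! ### Words in the root groups -/

/-- The word `[g₁, …, gₙ]` has at most five letters, and `gᵢ` belongs to the root group `Uᵢ` of the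
apartment `v`. -/
inductive RootWord (v : ZMod (2 * 6) → P ⊕ L) : List Γ.Collineation → Prop
  | nil : RootWord v []
  | snoc {l : List Γ.Collineation} {g : Γ.Collineation} (hl : RootWord v l) (hlen : l.length < 5)
      (hg : g ∈ Γ.apartmentRootGroup v (l.length + 1)) : RootWord v (l ++ [g])

namespace RootWord

variable {v : ZMod (2 * 6) → P ⊕ L} {l l' : List Γ.Collineation}

theorem length_le (hl : RootWord v l) : l.length ≤ 5 := by
  cases hl with
  | nil => exact Nat.zero_le 5
  | snoc _ hlen _ => rwa [List.length_append, List.length_singleton, Nat.succ_le_iff]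

theorem snoc_iff {g : Γ.Collineation} : RootWord v (l ++ [g]) ↔
    RootWord v l ∧ l.length < 5 ∧ g ∈ Γ.apartmentRootGroup v (l.length + 1) := by
  refine ⟨fun h => ?_, fun ⟨hl, hlen, hg⟩ => hl.snoc hlen hg⟩
  generalize e : l ++ [g] = m at h
  cases h with
  | nil => exact absurd e (List.append_ne_nil_of_right_ne_nil l (List.cons_ne_nil g []))
  | snoc hl hlen hg =>
    obtain ⟨rfl, e'⟩ := List.append_inj' e rfl
    obtain rfl := List.singleton_inj.1 e'
    exact ⟨hl, hlen, hg⟩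

theorem take (hl : RootWord v l) (n : ℕ) : RootWord v (l.take n) := by
  induction hl with
  | nil =>
    rw [List.take_nil]
    exact .nil
  | @snoc l g hl hlen hg ih =>
    rcases le_or_gt n l.length with hn | hn
    · rwa [List.take_append_of_le_length hn]
    · rw [List.take_of_length_le (by simpa using hn)]
      exact hl.snoc hlen hg

variable (hv : Γ.IsOrdinaryGon 6 v)
include hv

theorem last_smul_eq {n i : ℕ} (hn : n ≤ 5) (hi : i ≤ n + 1) {g : Γ.Collineation}
    (hg : g ∈ Γ.apartmentRootGroup v (n + 1)) : g • v (6 + i) = v (6 + i) := by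
  have h := smul_eq_of_mem_apartmentRootGroup hv hg (j := 5 - n + i) (by omega)
  have e : (n + 1 : ZMod (2 * 6)) + (5 - n + i : ℕ) = 6 + i := by
    push_cast [hn]
    ring
  rwa [e] at h

theorem prod_smul_snoc {i : ℕ} (hlen : l.length < 5) {g : Γ.Collineation}
    (hg : g ∈ Γ.apartmentRootGroup v (l.length + 1)) (hi : i ≤ l.length + 1) :
    (l ++ [g]).prod • v (6 + i) = l.prod • v (6 + i) := by
  rw [List.prod_append, List.prod_singleton, mul_smul, last_smul_eq hv hlen.le hi hg]

theorem prod_smul_base (hl : RootWord v l) {i : ℕ} (hi : i ≤ 1) :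
    l.prod • v (6 + i) = v (6 + i) := by
  induction hl with
  | nil => rw [List.prod_nil, one_smul]
  | snoc _ hlen hg ih => rwa [prod_smul_snoc hv hlen hg (by omega)]

theorem exists_of_isPath (hΓ : Γ.IsMoufangHexagon) {n : ℕ} (hn : n ≤ 5) {γ : ℕ → P ⊕ L}
    (hγ : Γ.IsPath (n + 1) γ) (h0 : γ 0 = v 6) (h1 : γ 1 = v 7) :
    ∃ l : List Γ.Collineation,
      RootWord v l ∧ l.length = n ∧ ∀ i ≤ n + 1, γ i = l.prod • v (6 + i) := by
  induction n with
  | zero =>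
    refine ⟨[], .nil, rfl, fun i hi => ?_⟩
    rw [List.prod_nil, one_smul]
    interval_cases i
    exacts [h0, h1]
  | succ n ih =>
    obtain ⟨l, hl, rfl, hγl⟩ := ih (by omega) (hγ.mono (by omega))
    have e₅ : (l.length + 1 : ZMod (2 * 6)) + 5 = 6 + l.length := by ring
    have e₆ : (l.length + 1 : ZMod (2 * 6)) + 6 = 6 + (l.length + 1 : ℕ) := by push_cast; ring
    have e₇ : (l.length + 1 : ZMod (2 * 6)) + 7 = 6 + (l.length + 1 + 1 : ℕ) := by push_cast; ring
    obtain ⟨g, hg, hgγ⟩ := hΓ.exists_smul_succ_eq hv (i := l.length + 1)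
      (y := l.prod⁻¹ • γ (l.length + 1 + 1))
      (by
        rw [e₆, ← adj_smul_iff l.prod, smul_inv_smul, ← hγl _ le_rfl]
        exact hγ.adj _ (by omega))
      (by
        rw [e₅, ne_eq, inv_smul_eq_iff, ← hγl _ (by omega)]
        exact (hγ.ne _ (by omega)).symm)
    refine ⟨l ++ [g], hl.snoc (by omega) hg, by rw [List.length_append, List.length_singleton],
      fun i hi => ?_⟩
    rcases Nat.le_or_eq_of_le_succ hi with hi | rfl
    · rw [prod_smul_snoc hv (by omega) hg hi, hγl i hi]
    · rw [List.prod_append, List.prod_singleton, mul_smul, ← e₇, hgγ, smul_inv_smul]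

theorem eq_of_forall_smul_eq (hΓ : Γ.IsMoufangHexagon) (hl : RootWord v l) (hl' : RootWord v l')
    (hlen : l.length = l'.length)
    (h : ∀ i ≤ l.length + 1, l.prod • v (6 + i) = l'.prod • v (6 + i)) : l = l' := by
  induction hl generalizing l' with
  | nil => exact (List.length_eq_zero_iff.1 hlen.symm).symm
  | @snoc l g _ hl5 hg ih =>
    cases hl' with
    | nil => simp at hlen
    | @snoc l' g' hl' hl5' hg' =>
      simp only [List.length_append, List.length_singleton, Nat.add_right_cancel_iff] at hlen h
      obtain rfl : l = l' := ih hl' hlen fun i hi => by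
        rw [← prod_smul_snoc hv hl5 hg hi, ← prod_smul_snoc hv hl5' hg' (hlen ▸ hi), h i (by omega)]
      have hlast := h (l.length + 1 + 1) le_rfl
      have e₇ : (6 : ZMod (2 * 6)) + (l.length + 1 + 1 : ℕ) = l.length + 1 + 7 := by
        push_cast
        ring
      rw [List.prod_append, List.prod_append, List.prod_singleton, List.prod_singleton, mul_smul,
        mul_smul, smul_left_cancel_iff, e₇] at hlast
      rw [hΓ.eq_of_smul_succ_eq hv hg hg' hlast]

end RootWord

/-- The two orientations of the apartment `v` that are compatible with its chamber `{v 6, v 7}`: a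
path that starts with `v 6, v 7` follows `v`, and a path that starts with `v 7, v 6` follows the
reversed apartment `j ↦ v (1 - j)`. -/
def orient (v : ZMod (2 * 6) → P ⊕ L) : Bool → ZMod (2 * 6) → P ⊕ L
  | true => v
  | false => fun j => v (1 - j)

theorem orient_not (v : ZMod (2 * 6) → P ⊕ L) (s : Bool) (j : ZMod (2 * 6)) :
    orient v (!s) j = orient v s (1 - j) := by
  cases s
  · exact congrArg v (sub_sub_cancel 1 j).symm
  · rfl

theorem IsOrdinaryGon.orient {v : ZMod (2 * 6) → P ⊕ L} (hv : Γ.IsOrdinaryGon 6 v) (s : Bool) :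
    Γ.IsOrdinaryGon 6 (orient v s) := by
  cases s
  exacts [hv.reflect 1, hv]

theorem apartmentRootGroup_orient_false (v : ZMod (2 * 6) → P ⊕ L) {i j : ZMod (2 * 6)}
    (h : i + j = 7) : Γ.apartmentRootGroup (orient v false) i = Γ.apartmentRootGroup v j := by
  rw [orient, apartmentRootGroup_reflect]
  congr 1
  revert i j
  decide

variable (Γ) in
/-- A side of the chamber `{v 6, v 7}` of an apartment `v` (as in `orient`), together with a list of
collineations, which is meant to be a root word for the corresponding orientation of `v`. -/
structure OrientedWord where
  side : Bool
  letters : List Γ.Collineation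

namespace OrientedWord

/-- The letters of `w` form a root word for the orientation of `v` given by the side of `w`. -/
def IsRootWord (v : ZMod (2 * 6) → P ⊕ L) (w : Γ.OrientedWord) : Prop :=
  RootWord (orient v w.side) w.letters

/-- The path that starts with the chamber `{v 6, v 7}` and is the image under `w` of a path in the
apartment `v`. -/
def path (v : ZMod (2 * 6) → P ⊕ L) (w : Γ.OrientedWord) (i : ℕ) : P ⊕ L :=
  w.letters.prod • orient v w.side (6 + i)

/-- The element of the geometry that is represented by `w`: if `w` has `n` letters, this is the
last element of its path of length `n + 1`. -/
def element (v : ZMod (2 * 6) → P ⊕ L) (w : Γ.OrientedWord) : P ⊕ L :=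
  w.path v (w.letters.length + 1)

/-- The element before the last one on the path that leads to `w.element v`. -/
def predecessor (v : ZMod (2 * 6) → P ⊕ L) (w : Γ.OrientedWord) : P ⊕ L :=
  w.path v w.letters.length

theorem predecessor_nil (v : ZMod (2 * 6) → P ⊕ L) (s : Bool) :
    (⟨s, []⟩ : Γ.OrientedWord).predecessor v = (⟨!s, []⟩ : Γ.OrientedWord).element v := by
  simp only [predecessor, element, path, orient_not]
  congr 2

variable {v : ZMod (2 * 6) → P ⊕ L} (hv : Γ.IsOrdinaryGon 6 v) {w w' : Γ.OrientedWord}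
include hv

theorem IsRootWord.predecessor_eq_element_dropLast (hw : w.IsRootWord v) (hne : w.letters ≠ []) :
    w.predecessor v = (⟨w.side, w.letters.dropLast⟩ : Γ.OrientedWord).element v := by
  obtain ⟨s, l⟩ := w
  obtain ⟨l, g, rfl⟩ := (List.eq_nil_or_concat' l).resolve_left hne
  obtain ⟨-, hlen, hg⟩ := RootWord.snoc_iff.1 hw
  rw [predecessor, element, path, path, List.length_append, List.dropLast_concat]
  exact RootWord.prod_smul_snoc (hv.orient s) hlen hg le_rfl

theorem isPath (w : Γ.OrientedWord) (n : ℕ) : Γ.IsPath n (w.path v) :=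
  ((hv.orient w.side).isPath (by decide) 6 n).smul w.letters.prod

theorem adj_predecessor (w : Γ.OrientedWord) : Γ.Adj (w.predecessor v) (w.element v) :=
  (w.isPath hv _).adj _ w.letters.length.lt_succ_self

theorem IsRootWord.path_eq (hw : w.IsRootWord v) {i : ℕ} (hi : i ≤ 1) :
    w.path v i = orient v w.side (6 + i) :=
  RootWord.prod_smul_base (hv.orient w.side) hw hi

theorem IsRootWord.path_zero_eq_path_one (hw : w.IsRootWord v) (hw' : w'.IsRootWord v)
    (hside : w.side ≠ w'.side) : w.path v 0 = w'.path v 1 := by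
  rw [hw.path_eq hv (by decide), hw'.path_eq hv (by decide), Bool.eq_not.2 hside, orient_not]
  congr 1

theorem exists_element_eq (hΓ : Γ.IsMoufangHexagon) (x : P ⊕ L) :
    ∃ w : Γ.OrientedWord, w.IsRootWord v ∧ w.element v = x := by
  obtain ⟨n, hn, γ, hγ, rfl, h⟩ := hΓ.1.exists_path_from (hv.2 6) x
  obtain ⟨s, h0, h1⟩ : ∃ s, γ 0 = orient v s 6 ∧ γ 1 = orient v s 7 := by
    rcases h with h | h
    exacts [⟨true, h⟩, ⟨false, h⟩]
  obtain ⟨l, hl, rfl, hγl⟩ := RootWord.exists_of_isPath (hv.orient s) hΓ hn hγ h0 h1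
  exact ⟨⟨s, l⟩, hl, (hγl _ le_rfl).symm⟩

theorem side_eq_of_element_eq (hΓ : Γ.IsGeneralisedHexagon) (hw : w.IsRootWord v)
    (hw' : w'.IsRootWord v) (e : w.element v = w'.element v) : w.side = w'.side := by
  by_contra hside
  exact hΓ.path_end_ne (w.isPath hv _) (w'.isPath hv _) (Nat.succ_pos _) (Nat.succ_pos _)
    (Nat.succ_le_succ (RootWord.length_le hw)) (Nat.succ_le_succ (RootWord.length_le hw'))
    (hw.path_zero_eq_path_one hv hw' hside)
    (hw'.path_zero_eq_path_one hv hw (Ne.symm hside)).symm e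

theorem eq_of_element_eq (hΓ : Γ.IsMoufangHexagon) (hw : w.IsRootWord v)
    (hw' : w'.IsRootWord v) (e : w.element v = w'.element v) : w = w' := by
  have hside := side_eq_of_element_eq hv hΓ.1 hw hw' e
  have hlen := RootWord.length_le hw
  have hlen' := RootWord.length_le hw'
  have path_eq : ∀ i ≤ 1, w.path v i = w'.path v i := fun i hi => by
    rw [hw.path_eq hv hi, hw'.path_eq hv hi, hside]
  obtain ⟨hlen_eq, heq⟩ := hΓ.1.path_unique
    ((w.isPath hv (w.letters.length + 1)).shift 1 (m := w.letters.length) (by omega))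
    ((w'.isPath hv (w'.letters.length + 1)).shift 1 (m := w'.letters.length) (by omega))
    (by omega) (path_eq 1 le_rfl)
    (by rwa [add_comm, add_comm 1])
  obtain ⟨s, l⟩ := w
  obtain ⟨s', l'⟩ := w'
  obtain rfl : s = s' := hside
  congr 1
  refine RootWord.eq_of_forall_smul_eq (hv.orient s) hΓ hw hw' hlen_eq fun i hi => ?_
  cases i with
  | zero => exact path_eq 0 (by decide)
  | succ i => exact add_comm 1 i ▸ heq i (Nat.le_of_succ_le_succ hi)

theorem adj_element_iff (hΓ : Γ.IsGeneralisedHexagon) (hw : w.IsRootWord v)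
    (hw' : w'.IsRootWord v) (hlen : w.letters.length + w'.letters.length ≤ 9) :
    Γ.Adj (w.element v) (w'.element v) ↔
      w.predecessor v = w'.element v ∨ w'.predecessor v = w.element v := by
  refine ⟨fun hadj => ?_, ?_⟩
  · have from_seven : ∀ u : Γ.OrientedWord, Γ.IsPath u.letters.length fun i => u.path v (1 + i) :=
      fun u => (u.isPath hv (1 + u.letters.length)).shift 1 le_rfl
    have last : ∀ u : Γ.OrientedWord, u.path v (1 + u.letters.length) = u.element v :=
      fun u => by rw [add_comm, element]
    have last_but_one : ∀ u : Γ.OrientedWord, 0 < u.letters.length →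
        u.path v (1 + (u.letters.length - 1)) = u.predecessor v :=
      fun u hu => by rw [Nat.add_sub_cancel' hu, predecessor]
    rw [← last w] at hadj ⊢
    by_cases hside : w.side = w'.side
    · have e : w.path v 1 = w'.path v 1 := by
        rw [hw.path_eq hv le_rfl, hw'.path_eq hv le_rfl, hside]
      rw [← last w'] at hadj ⊢
      refine (hΓ.penultimate_eq_of_adj (from_seven w) (from_seven w') (by omega) e hadj).imp ?_ ?_
      · exact fun ⟨hpos, h⟩ => last_but_one w hpos ▸ h
      · exact fun ⟨hpos, h⟩ => last_but_one w' hpos ▸ h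
    · refine (hΓ.penultimate_eq_of_adj (from_seven w) (w'.isPath hv _) (by omega)
        (hw'.path_zero_eq_path_one hv hw (Ne.symm hside)).symm hadj).imp ?_ And.right
      exact fun ⟨hpos, h⟩ => last_but_one w hpos ▸ h
  · rintro (h | h)
    · exact h ▸ (w.adj_predecessor hv).symm
    · exact h ▸ w'.adj_predecessor hv

end OrientedWord

end PointLineGeometry

/-! ### Commutator calculus -/

theorem semiconjBy_of_rootCommutator {G : Type*} [Group G] {g h h' k : G}
    (e : rootCommutator g h = k) (hk : h' * k = h) : SemiconjBy g h' h := by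
  rw [← eq_mul_inv_iff_mul_eq] at hk
  rw [SemiconjBy, hk, ← e, rootCommutator]
  group

theorem commute_of_rootCommutator {G : Type*} [Group G] {g h : G}
    (e : rootCommutator g h = 1) : Commute g h :=
  semiconjBy_of_rootCommutator e (mul_one h)

theorem ParametrisesSubgroup.map_zero {A G : Type*} [AddGroup A] [Group G] {x : A → G}
    {U : Subgroup G} (h : ParametrisesSubgroup x U) : x 0 = 1 := by
  simpa only [add_zero, left_eq_mul] using h.1 0 0

theorem ParametrisesSubgroup.mem {A G : Type*} [AddGroup A] [Group G] {x : A → G}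
    {U : Subgroup G} (h : ParametrisesSubgroup x U) (a : A) : x a ∈ U := by
  rw [← SetLike.mem_coe, ← h.2.2]
  exact Set.mem_range_self a

theorem ParametrisesSubgroup.exists_eq {A G : Type*} [AddGroup A] [Group G] {x : A → G}
    {U : Subgroup G} (h : ParametrisesSubgroup x U) {g : G} (hg : g ∈ U) : ∃ a, x a = g := by
  rwa [← SetLike.mem_coe, ← h.2.2] at hg

namespace HexagonalSystem

variable {F J : Type*} [Field F] [AddCommGroup J] [Module F J] (H : HexagonalSystem F J)

theorem cross_self (a : J) : H.cross a a = (2 : F) • H.sharp a := by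
  have h := H.sharp_add a a
  rw [← two_smul F a, H.sharp_smul, ← sub_eq_iff_eq_add, ← sub_eq_iff_eq_add'] at h
  rw [← h]
  module

theorem T_cross_self_left (a b : J) : H.T (H.cross a b) a = 2 * H.T (H.sharp a) b := by
  rw [H.T_symm, H.T_cross, H.cross_self, map_smul, LinearMap.smul_apply, smul_eq_mul]

theorem T_cross_self_right (a b : J) : H.T (H.cross b a) a = 2 * H.T (H.sharp a) b := by
  rw [H.cross_symm, H.T_cross_self_left]

theorem T_sharp_self (a : J) : H.T (H.sharp a) a = 3 * H.N a := by
  rw [H.T_symm, H.T_sharp]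

theorem sharp_sub_smul (t : F) (a b : J) :
    H.sharp (a - t • b) = H.sharp a - t • H.cross a b + t ^ 2 • H.sharp b := by
  rw [sub_eq_add_neg, ← neg_smul, H.sharp_add, H.sharp_smul, map_smul, neg_sq, neg_smul,
    sub_eq_add_neg]

end HexagonalSystem

namespace HexagonLabelling

variable {P L F J : Type*} [Field F] [AddCommGroup J] [Module F J]
  {Γ : PointLineGeometry P L} {H : HexagonalSystem F J} (D : HexagonLabelling Γ H)

/-- The elements of the subgroup `U₂ U₃ U₄ U₅ U₆`, which `U₁` normalises, in normal form. -/
def normalForm (u : F) (a : J) (r : F) (d : J) (e : F) : Γ.Collineation :=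
  D.x₂ u * D.x₃ a * D.x₄ r * D.x₅ d * D.x₆ e

theorem x₂_eq_normalForm (u : F) : D.x₂ u = D.normalForm u 0 0 0 0 := by
  simp only [normalForm, D.param₃.map_zero, D.param₄.map_zero, D.param₅.map_zero,
    D.param₆.map_zero, mul_one]

theorem x₃_eq_normalForm (a : J) : D.x₃ a = D.normalForm 0 a 0 0 0 := by
  simp only [normalForm, D.param₂.map_zero, D.param₄.map_zero, D.param₅.map_zero,
    D.param₆.map_zero, mul_one, one_mul]

theorem x₄_eq_normalForm (r : F) : D.x₄ r = D.normalForm 0 0 r 0 0 := by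
  simp only [normalForm, D.param₂.map_zero, D.param₃.map_zero, D.param₅.map_zero,
    D.param₆.map_zero, mul_one, one_mul]

theorem x₅_eq_normalForm (d : J) : D.x₅ d = D.normalForm 0 0 0 d 0 := by
  simp only [normalForm, D.param₂.map_zero, D.param₃.map_zero, D.param₄.map_zero,
    D.param₆.map_zero, mul_one, one_mul]

theorem x₆_eq_normalForm (e : F) : D.x₆ e = D.normalForm 0 0 0 0 e := by
  simp only [normalForm, D.param₂.map_zero, D.param₃.map_zero, D.param₄.map_zero,
    D.param₅.map_zero, one_mul]

theorem semiconjBy_x₂_x₆ (u e : F) :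
    SemiconjBy (D.x₂ u) (D.x₄ (-(u * e)) * D.x₆ e) (D.x₆ e) := by
  refine semiconjBy_of_rootCommutator (D.comm₂₆ u e) ?_
  rw [mul_assoc, ← (commute_of_rootCommutator (D.comm₄₆ _ _)).eq, ← mul_assoc, ← D.param₄.1,
    neg_add_cancel, D.param₄.map_zero, one_mul]

theorem semiconjBy_x₃_x₅ (a d : J) :
    SemiconjBy (D.x₃ a) (D.x₄ (-H.T a d) * D.x₅ d) (D.x₅ d) := by
  refine semiconjBy_of_rootCommutator (D.comm₃₅ a d) ?_
  rw [mul_assoc, ← (commute_of_rootCommutator (D.comm₄₅ _ _)).eq, ← mul_assoc, ← D.param₄.1,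
    neg_add_cancel, D.param₄.map_zero, one_mul]

theorem normalForm_mul_x₂ (u s : F) (a : J) (r : F) (d : J) (e : F) :
    D.normalForm u a r d e * D.x₂ s = D.normalForm (u + s) a (r - s * e) d e := by
  have h := ((((commute_of_rootCommutator (D.comm₂₃ s a)).mul_right
    (commute_of_rootCommutator (D.comm₂₄ s r))).mul_right
    (commute_of_rootCommutator (D.comm₂₅ s d))).semiconjBy.mul_right (D.semiconjBy_x₂_x₆ s e)).eq
  have h₄₅ := (commute_of_rootCommutator (D.comm₄₅ (-(s * e)) d)).left_comm (D.x₆ e)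
  simp only [normalForm, D.param₂.1, sub_eq_add_neg, D.param₄.1, mul_assoc, h₄₅] at h ⊢
  rw [h]

theorem normalForm_mul_x₃ (u : F) (a c : J) (r : F) (d : J) (e : F) :
    D.normalForm u a r d e * D.x₃ c = D.normalForm u (a + c) (r - H.T c d) d e := by
  have h := (((commute_of_rootCommutator (D.comm₃₄ c r)).semiconjBy.mul_right
    (D.semiconjBy_x₃_x₅ c d)).mul_right (commute_of_rootCommutator (D.comm₃₆ c e)).semiconjBy).eq
  simp only [normalForm, D.param₃.1, sub_eq_add_neg, D.param₄.1, mul_assoc] at h ⊢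
  rw [h]

theorem normalForm_mul_x₄ (u : F) (a : J) (r q : F) (d : J) (e : F) :
    D.normalForm u a r d e * D.x₄ q = D.normalForm u a (r + q) d e := by
  have h := ((commute_of_rootCommutator (D.comm₄₅ q d)).mul_right
    (commute_of_rootCommutator (D.comm₄₆ q e))).eq
  simp only [normalForm, D.param₄.1, mul_assoc] at h ⊢
  rw [h]

theorem normalForm_mul_x₅ (u : F) (a : J) (r : F) (d f : J) (e : F) :
    D.normalForm u a r d e * D.x₅ f = D.normalForm u a r (d + f) e := by
  simp only [normalForm, D.param₅.1, mul_assoc, (commute_of_rootCommutator (D.comm₅₆ f e)).eq]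

theorem normalForm_mul_x₆ (u : F) (a : J) (r : F) (d : J) (e g : F) :
    D.normalForm u a r d e * D.x₆ g = D.normalForm u a r d (e + g) := by
  rw [normalForm, normalForm, D.param₆.1, ← mul_assoc]

theorem normalForm_mul_normalForm (u s : F) (a c : J) (r q : F) (d f : J) (e g : F) :
    D.normalForm u a r d e * D.normalForm s c q f g =
      D.normalForm (u + s) (a + c) (r - s * e - H.T c d + q) (d + f) (e + g) := by
  have h : D.normalForm s c q f g = D.x₂ s * D.x₃ c * D.x₄ q * D.x₅ f * D.x₆ g := rfl
  simp only [h, ← mul_assoc, normalForm_mul_x₂, normalForm_mul_x₃, normalForm_mul_x₄,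
    normalForm_mul_x₅, normalForm_mul_x₆]

theorem semiconjBy_x₁_x₂ (b : J) (u : F) : SemiconjBy (D.x₁ b) (D.normalForm u 0 0 0 0) (D.x₂ u) :=
  D.x₂_eq_normalForm u ▸ commute_of_rootCommutator (D.comm₁₂ b u)

theorem semiconjBy_x₁_x₃ (b a : J) :
    SemiconjBy (D.x₁ b) (D.normalForm (-H.T b a) a 0 0 0) (D.x₃ a) := by
  refine semiconjBy_of_rootCommutator (D.comm₁₃ b a) ?_
  rw [normalForm_mul_x₂, x₃_eq_normalForm]
  simp

theorem semiconjBy_x₁_x₄ (b : J) (r : F) :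
    SemiconjBy (D.x₁ b) (D.normalForm 0 0 r 0 0) (D.x₄ r) :=
  D.x₄_eq_normalForm r ▸ commute_of_rootCommutator (D.comm₁₄ b r)

theorem semiconjBy_x₁_x₅ (b d : J) : SemiconjBy (D.x₁ b)
    (D.normalForm (H.T (H.sharp b) d) (-H.cross b d) (H.T b (H.sharp d)) d 0) (D.x₅ d) := by
  refine semiconjBy_of_rootCommutator (D.comm₁₅ b d) ?_
  rw [← mul_assoc, ← mul_assoc, normalForm_mul_x₂, normalForm_mul_x₃, normalForm_mul_x₄,
    x₅_eq_normalForm]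
  congr 1
  · ring
  · abel
  · rw [H.T_cross_self_right, H.T_symm b]
    ring

theorem semiconjBy_x₁_x₆ (b : J) (e : F) : SemiconjBy (D.x₁ b)
    (D.normalForm (e * H.N b) (-(e • H.sharp b)) (e ^ 2 * H.N b) (e • b) e) (D.x₆ e) := by
  refine semiconjBy_of_rootCommutator (D.comm₁₆ b e) ?_
  simp only [← mul_assoc, normalForm_mul_x₂, normalForm_mul_x₃, normalForm_mul_x₄,
    normalForm_mul_x₅, x₆_eq_normalForm]
  congr 1
  · ring
  · abel
  · simp only [H.T_sharp_self, neg_mul, sub_neg_eq_add, map_smul, LinearMap.smul_apply,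
      smul_eq_mul]
    ring
  · abel

theorem mul_x₁_eq_x₁_mul (t : F) (a : J) (t' : F) (a' : J) (t'' : F) (b : J) :
    D.x₆ t * D.x₅ a * D.x₄ t' * D.x₃ a' * D.x₂ t'' * D.x₁ b =
      D.x₁ b * D.normalForm (t'' + t * H.N b - H.T a' b + H.T a (H.sharp b))
        (a' - H.cross a b - t • H.sharp b)
        (t' + t ^ 2 * H.N b - t * t'' + t * H.T a (H.sharp b) + H.T (H.sharp a) b - H.T a a')
        (a + t • b) t := by
  have h := ((((D.semiconjBy_x₁_x₆ b t).mul_right (D.semiconjBy_x₁_x₅ b a)).mul_right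
    (D.semiconjBy_x₁_x₄ b t')).mul_right (D.semiconjBy_x₁_x₃ b a')).mul_right
    (D.semiconjBy_x₁_x₂ b t'')
  rw [← h.eq]
  simp only [normalForm_mul_normalForm]
  congr 2
  · rw [H.T_symm b, H.T_symm (H.sharp b)]
    ring
  · rw [H.cross_symm b]
    abel
  · simp only [H.T_cross_self_right, H.T_symm (H.sharp b), H.cross_symm b a, H.T_symm b,
      H.T_symm a' a, map_neg, map_smul, LinearMap.neg_apply, smul_eq_mul, mul_neg, sub_neg_eq_add,
      add_zero, zero_mul, sub_zero, map_zero, LinearMap.zero_apply, neg_mul, map_add]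
    ring
  · abel
  · ring

end HexagonLabelling

theorem HexagonalSystem.incidence_equations_iff {F J : Type*}
    [Field F] [AddCommGroup J] [Module F J]
    (H : HexagonalSystem F J) (t t' t'' u u' : F) (a a' b b' b'' : J) :
    (u = t'' + t * H.N b - H.T a' b + H.T a (H.sharp b) ∧
      b' = a' - H.cross a b - t • H.sharp b ∧
      u' = t' + t ^ 2 * H.N b - t * t'' + t * H.T a (H.sharp b) + H.T (H.sharp a) b
        - H.T a a' ∧
      b'' = a + t • b) ↔
    (a = b'' - t • b ∧
      t' = u' + t ^ 2 * H.N b + u * t - t * H.T b'' (H.sharp b) + H.T b' b''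
        + H.T (H.sharp b'') b ∧
      a' = b' + H.cross b b'' - t • H.sharp b ∧
      t'' = u - t * H.N b + H.T b b' + H.T b'' (H.sharp b)) := by
  constructor
  · rintro ⟨rfl, rfl, rfl, rfl⟩
    refine ⟨by abel, ?_, ?_, ?_⟩
    · simp only [H.T_sharp, H.T_cross_self_left, H.T_cross_self_right, H.T_sharp_self, H.sharp_add,
        H.sharp_smul, H.T_symm a' a, H.T_symm (H.sharp b) a, map_add, map_smul,
        LinearMap.add_apply, LinearMap.smul_apply, smul_eq_mul, map_sub, LinearMap.sub_apply]
      ring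
    · simp only [H.cross_self, H.cross_symm b a, map_add, map_smul]
      module
    · simp only [H.T_cross_self_right, H.T_sharp_self, H.T_sharp, H.T_symm b,
        H.T_symm (H.sharp b) a, map_sub, map_smul, LinearMap.sub_apply, LinearMap.smul_apply,
        smul_eq_mul, map_add, LinearMap.add_apply]
      ring
  · rintro ⟨rfl, rfl, rfl, rfl⟩
    refine ⟨?_, ?_, ?_, by abel⟩
    · simp only [H.T_cross_self_left, H.T_sharp_self, H.T_sharp, H.T_symm b,
        H.T_symm (H.sharp b) b'', map_sub, map_add, map_smul, LinearMap.sub_apply,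
        LinearMap.add_apply, LinearMap.smul_apply, smul_eq_mul]
      ring
    · simp only [H.cross_self, H.cross_symm b b'', map_sub, map_smul, LinearMap.sub_apply,
        LinearMap.smul_apply]
      module
    · simp only [H.T_sharp, H.sharp_sub_smul, H.T_cross_self_right, H.T_sharp_self,
        H.T_cross_self_left, H.T_symm b, H.T_symm (H.sharp b) b'', H.cross_symm b b'',
        H.T_symm b'' b', H.T_symm b'' (H.cross _ _), map_sub, map_smul, LinearMap.sub_apply,
        LinearMap.smul_apply, smul_eq_mul, map_add, LinearMap.add_apply]
      ring

/-! ### Labels as words in the root groups -/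

/-- The line label that precedes a point label on the path from the chamber `(∞) * [∞]`: its last
coordinate is removed. -/
def PointLabel.parent {F J : Type*} : PointLabel F J → LineLabel F J
  | .infty => .infty
  | .one _ => .infty
  | .two b _ => .one b
  | .three t a _ => .two t a
  | .four b u b' _ => .three b u b'
  | .five t a t' a' _ => .four t a t' a'

/-- The point label that precedes a line label on the path from the chamber `(∞) * [∞]`: its last
coordinate is removed. -/
def LineLabel.parent {F J : Type*} : LineLabel F J → PointLabel F J
  | .infty => .infty
  | .one _ => .infty
  | .two t _ => .one t
  | .three b u _ => .two b u
  | .four t a t' _ => .three t a t'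
  | .five b u b' u' _ => .four b u b' u'

theorem chainIncident_iff {F J : Type*} {p : PointLabel F J} {l : LineLabel F J} :
    ChainIncident p l ↔ p.parent = l ∨ l.parent = p := by
  constructor
  · rintro (_ | _) <;> simp only [PointLabel.parent, LineLabel.parent, true_or, or_true]
  · rintro (rfl | rfl)
    · cases p <;> constructor
    · cases l <;> constructor

namespace HexagonLabelling

open PointLineGeometry

variable {P L F J : Type*} [Field F] [AddCommGroup J] [Module F J]
  {Γ : PointLineGeometry P L} {H : HexagonalSystem F J} (D : HexagonLabelling Γ H)

/-- The word in the root groups that a label spells out. The words of labels starting with an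
element of `J` follow the apartment, those starting with an element of `F` follow it backwards. -/
def word : PointLabel F J ⊕ LineLabel F J → Γ.OrientedWord
  | .inl .infty => ⟨true, []⟩
  | .inr .infty => ⟨false, []⟩
  | .inl (.one t) => ⟨false, [D.x₆ t]⟩
  | .inr (.one b) => ⟨true, [D.x₁ b]⟩
  | .inl (.two b u) => ⟨true, [D.x₁ b, D.x₂ u]⟩
  | .inr (.two t a) => ⟨false, [D.x₆ t, D.x₅ a]⟩
  | .inl (.three t a t') => ⟨false, [D.x₆ t, D.x₅ a, D.x₄ t']⟩
  | .inr (.three b u b') => ⟨true, [D.x₁ b, D.x₂ u, D.x₃ b']⟩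
  | .inl (.four b u b' u') => ⟨true, [D.x₁ b, D.x₂ u, D.x₃ b', D.x₄ u']⟩
  | .inr (.four t a t' a') => ⟨false, [D.x₆ t, D.x₅ a, D.x₄ t', D.x₃ a']⟩
  | .inl (.five t a t' a' t'') => ⟨false, [D.x₆ t, D.x₅ a, D.x₄ t', D.x₃ a', D.x₂ t'']⟩
  | .inr (.five b u b' u' b'') => ⟨true, [D.x₁ b, D.x₂ u, D.x₃ b', D.x₄ u', D.x₅ b'']⟩

theorem rootWord_x₁_x₂_x₃_x₄_x₅ (b : J) (u : F) (b' : J) (u' : F) (b'' : J) :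
    RootWord D.v [D.x₁ b, D.x₂ u, D.x₃ b', D.x₄ u', D.x₅ b''] :=
  ((((RootWord.nil.snoc (by simp) (D.param₁.mem b)).snoc (by simp) (D.param₂.mem u)).snoc
    (by simp) (D.param₃.mem b')).snoc (by simp) (D.param₄.mem u')).snoc (by simp)
    (D.param₅.mem b'')

theorem rootWord_x₆_x₅_x₄_x₃_x₂ (t : F) (a : J) (t' : F) (a' : J) (t'' : F) :
    RootWord (orient D.v false) [D.x₆ t, D.x₅ a, D.x₄ t', D.x₃ a', D.x₂ t''] := by
  have mem {g i j} (h : i + j = 7) (hg : g ∈ Γ.apartmentRootGroup D.v j) :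
      g ∈ Γ.apartmentRootGroup (orient D.v false) i :=
    (apartmentRootGroup_orient_false D.v h).ge hg
  have h₁ := mem (i := 1) (by decide) (D.param₆.mem t)
  have h₂ := mem (i := 2) (by decide) (D.param₅.mem a)
  have h₃ := mem (i := 3) (by decide) (D.param₄.mem t')
  have h₄ := mem (i := 4) (by decide) (D.param₃.mem a')
  have h₅ := mem (i := 5) (by decide) (D.param₂.mem t'')
  exact ((((RootWord.nil.snoc (by simp) h₁).snoc (by simp) h₂).snoc (by simp) h₃).snoc (by simp)
    h₄).snoc (by simp) h₅

theorem isRootWord_word : ∀ x, (D.word x).IsRootWord D.v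
  | .inl .infty | .inr .infty => .nil
  | .inl (.one t) => (D.rootWord_x₆_x₅_x₄_x₃_x₂ t 0 0 0 0).take 1
  | .inr (.one b) => (D.rootWord_x₁_x₂_x₃_x₄_x₅ b 0 0 0 0).take 1
  | .inl (.two b u) => (D.rootWord_x₁_x₂_x₃_x₄_x₅ b u 0 0 0).take 2
  | .inr (.two t a) => (D.rootWord_x₆_x₅_x₄_x₃_x₂ t a 0 0 0).take 2
  | .inl (.three t a t') => (D.rootWord_x₆_x₅_x₄_x₃_x₂ t a t' 0 0).take 3
  | .inr (.three b u b') => (D.rootWord_x₁_x₂_x₃_x₄_x₅ b u b' 0 0).take 3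
  | .inl (.four b u b' u') => (D.rootWord_x₁_x₂_x₃_x₄_x₅ b u b' u' 0).take 4
  | .inr (.four t a t' a') => (D.rootWord_x₆_x₅_x₄_x₃_x₂ t a t' a' 0).take 4
  | .inl (.five t a t' a' t'') => D.rootWord_x₆_x₅_x₄_x₃_x₂ t a t' a' t''
  | .inr (.five b u b' u' b'') => D.rootWord_x₁_x₂_x₃_x₄_x₅ b u b' u' b''

theorem word_injective : Function.Injective D.word := by
  rintro (x | x) (y | y) <;> cases x <;> cases y <;>
    simp [word, D.param₁.2.1.eq_iff, D.param₂.2.1.eq_iff, D.param₃.2.1.eq_iff, D.param₄.2.1.eq_iff,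
      D.param₅.2.1.eq_iff, D.param₆.2.1.eq_iff]

theorem exists_word_snoc_eq (x : PointLabel F J ⊕ LineLabel F J) {g : Γ.Collineation}
    (hw : RootWord (orient D.v (D.word x).side) ((D.word x).letters ++ [g])) :
    ∃ y, D.word y = ⟨(D.word x).side, (D.word x).letters ++ [g]⟩ := by
  obtain ⟨-, hlen, hg⟩ := RootWord.snoc_iff.1 hw
  have left {i j} (h : i + j = 7) (hg : g ∈ Γ.apartmentRootGroup (orient D.v false) i) :
      g ∈ Γ.apartmentRootGroup D.v j :=
    (apartmentRootGroup_orient_false D.v h).le hg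
  rcases x with p | l
  · cases p with
    | infty =>
      obtain ⟨b, rfl⟩ := D.param₁.exists_eq hg
      exact ⟨.inr (.one b), rfl⟩
    | one t =>
      obtain ⟨a, rfl⟩ := D.param₅.exists_eq (left (i := 2) (by decide) hg)
      exact ⟨.inr (.two t a), rfl⟩
    | two b u =>
      obtain ⟨b', rfl⟩ := D.param₃.exists_eq hg
      exact ⟨.inr (.three b u b'), rfl⟩
    | three t a t' =>
      obtain ⟨a', rfl⟩ := D.param₃.exists_eq (left (i := 4) (by decide) hg)
      exact ⟨.inr (.four t a t' a'), rfl⟩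
    | four b u b' u' =>
      obtain ⟨b'', rfl⟩ := D.param₅.exists_eq hg
      exact ⟨.inr (.five b u b' u' b''), rfl⟩
    | five => simp [word] at hlen
  · cases l with
    | infty =>
      obtain ⟨t, rfl⟩ := D.param₆.exists_eq (left (i := 1) (by decide) hg)
      exact ⟨.inl (.one t), rfl⟩
    | one b =>
      obtain ⟨u, rfl⟩ := D.param₂.exists_eq hg
      exact ⟨.inl (.two b u), rfl⟩
    | two t a =>
      obtain ⟨t', rfl⟩ := D.param₄.exists_eq (left (i := 3) (by decide) hg)
      exact ⟨.inl (.three t a t'), rfl⟩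
    | three b u b' =>
      obtain ⟨u', rfl⟩ := D.param₄.exists_eq hg
      exact ⟨.inl (.four b u b' u'), rfl⟩
    | four t a t' a' =>
      obtain ⟨t'', rfl⟩ := D.param₂.exists_eq (left (i := 5) (by decide) hg)
      exact ⟨.inl (.five t a t' a' t''), rfl⟩
    | five => simp [word] at hlen

theorem exists_word_eq {w : Γ.OrientedWord} (hw : w.IsRootWord D.v) : ∃ x, D.word x = w := by
  obtain ⟨s, l⟩ := w
  induction l using List.reverseRecOn with
  | nil =>
    cases s
    exacts [⟨.inr .infty, rfl⟩, ⟨.inl .infty, rfl⟩]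
  | append_singleton l g ih =>
    obtain ⟨x, hx⟩ := ih (RootWord.snoc_iff.1 hw).1
    obtain ⟨rfl, rfl⟩ := OrientedWord.mk.inj hx
    exact D.exists_word_snoc_eq x hw

theorem predecessor_word : ∀ x, (D.word x).predecessor D.v =
    (D.word (x.elim (.inr ∘ PointLabel.parent) (.inl ∘ LineLabel.parent))).element D.v
  | .inl .infty | .inr .infty => OrientedWord.predecessor_nil D.v _
  | .inl (.one _) | .inr (.one _) | .inl (.two _ _) | .inr (.two _ _) | .inl (.three _ _ _)
  | .inr (.three _ _ _) | .inl (.four _ _ _ _) | .inr (.four _ _ _ _) | .inl (.five _ _ _ _ _)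
  | .inr (.five _ _ _ _ _) => (D.isRootWord_word _).predecessor_eq_element_dropLast D.apartment
      (List.cons_ne_nil _ _)

theorem inl_onPoint (g : Γ.Collineation) : Sum.inl (Collineation.onPoint g D.p₀) = g • D.v 7 := by
  rw [D.v_seven]
  rfl

theorem inr_onLine (g : Γ.Collineation) : Sum.inr (Collineation.onLine g D.L₀) = g • D.v 6 := by
  rw [D.v_six]
  rfl

section Reflections

variable (hΓ : Γ.IsMoufangHexagon) {D}
  {s₁ s₆ : Γ.Collineation} (h₁ : D.RepresentsS₁ s₁) (h₆ : D.RepresentsS₆ s₆)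

include h₁ in
theorem RepresentsS₁.smul_eq (j : ZMod (2 * 6)) : s₁ • D.v j = D.v (14 - j) := h₁ j

include h₆ in
theorem RepresentsS₆.smul_eq (j : ZMod (2 * 6)) : s₆ • D.v j = D.v (12 - j) := h₆ j

include h₁ h₆

theorem element_word (x : PointLabel F J ⊕ LineLabel F J) :
    (D.word x).element D.v = x.map (D.point s₁ s₆) (D.line s₁ s₆) := by
  rcases x with p | l
  · cases p <;> simp only [word, OrientedWord.element, OrientedWord.path, Sum.map_inl, point,
      inl_onPoint, mul_smul, h₁.smul_eq, h₆.smul_eq, List.prod_cons, List.prod_nil, one_smul,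
      D.v_seven.symm] <;> congr
    exact congrArg D.v (by simp only [List.length_cons, List.length_nil]; decide)
  · cases l <;> simp only [word, OrientedWord.element, OrientedWord.path, Sum.map_inr, line,
      inr_onLine, mul_smul, h₁.smul_eq, h₆.smul_eq, List.prod_cons, List.prod_nil, one_smul,
      D.v_six.symm] <;> congr

theorem inl_point_five (t : F) (a : J) (t' : F) (a' : J) (t'' : F) :
    .inl (D.point s₁ s₆ (.five t a t' a' t'')) =
      (D.x₆ t * D.x₅ a * D.x₄ t' * D.x₃ a' * D.x₂ t'') • D.v 1 := by
  simp only [point, inl_onPoint, mul_smul, h₁.smul_eq, h₆.smul_eq]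
  congr

theorem inr_line_four (t : F) (a : J) (t' : F) (a' : J) :
    .inr (D.line s₁ s₆ (.four t a t' a')) = (D.x₆ t * D.x₅ a * D.x₄ t' * D.x₃ a') • D.v 2 := by
  simp only [line, inr_onLine, mul_smul, h₁.smul_eq, h₆.smul_eq]
  congr

theorem inr_line_five (b : J) (u : F) (b' : J) (u' : F) (b'' : J) :
    .inr (D.line s₁ s₆ (.five b u b' u' b'')) =
      (D.x₁ b * D.x₂ u * D.x₃ b' * D.x₄ u' * D.x₅ b'') • D.v 0 := by
  simp only [line, inr_onLine, mul_smul, h₁.smul_eq, h₆.smul_eq]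
  congr

include hΓ

theorem map_point_line_bijective : Function.Bijective (Sum.map (D.point s₁ s₆) (D.line s₁ s₆)) := by
  simp only [Function.Bijective, Function.Injective, Function.Surjective, ← element_word h₁ h₆]
  constructor
  · intro x y e
    exact D.word_injective (OrientedWord.eq_of_element_eq D.apartment hΓ (D.isRootWord_word x)
      (D.isRootWord_word y) e)
  · intro z
    obtain ⟨w, hw, rfl⟩ := OrientedWord.exists_element_eq D.apartment hΓ z
    obtain ⟨x, rfl⟩ := D.exists_word_eq hw
    exact ⟨x, rfl⟩

theorem inc_iff_chainIncident {p : PointLabel F J} {l : LineLabel F J}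
    (hpl : ¬ (p.IsGeneric ∧ l.IsGeneric)) :
    Γ.Inc (D.point s₁ s₆ p) (D.line s₁ s₆ l) ↔ ChainIncident p l := by
  have hlen : (D.word (.inl p)).letters.length + (D.word (.inr l)).letters.length ≤ 9 := by
    cases p <;> cases l <;> simp [word, PointLabel.IsGeneric, LineLabel.IsGeneric] at hpl ⊢
  have hadj := OrientedWord.adj_element_iff D.apartment hΓ.1 (D.isRootWord_word _)
    (D.isRootWord_word _) hlen
  have hinj := (map_point_line_bijective hΓ h₁ h₆).injective
  simp only [predecessor_word, element_word h₁ h₆, hinj.eq_iff, Sum.elim_inl, Sum.elim_inr,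
    Function.comp_apply, Sum.inl.injEq, Sum.inr.injEq] at hadj
  exact hadj.trans chainIncident_iff.symm

theorem adj_inl_point_five_iff (t : F) (a : J) (t' : F) (a' : J) (t'' : F) (y : P ⊕ L) :
    Γ.Adj (.inl (D.point s₁ s₆ (.five t a t' a' t''))) y ↔
      y = .inr (D.line s₁ s₆ (.four t a t' a')) ∨
      ∃ b, y = .inr (D.line s₁ s₆ (.five b (t'' + t * H.N b - H.T a' b + H.T a (H.sharp b))
        (a' - H.cross a b - t • H.sharp b)
        (t' + t ^ 2 * H.N b - t * t'' + t * H.T a (H.sharp b) + H.T (H.sharp a) b - H.T a a')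
        (a + t • b))) := by
  have hline : ∀ b, (D.x₆ t * D.x₅ a * D.x₄ t' * D.x₃ a' * D.x₂ t'' * D.x₁ b) • D.v 0 =
      .inr (D.line s₁ s₆ (.five b (t'' + t * H.N b - H.T a' b + H.T a (H.sharp b))
        (a' - H.cross a b - t • H.sharp b)
        (t' + t ^ 2 * H.N b - t * t'' + t * H.T a (H.sharp b) + H.T (H.sharp a) b - H.T a a')
        (a + t • b))) := fun b => by
    have h₀ : D.x₆ t • D.v 0 = D.v 0 :=
      smul_eq_of_mem_apartmentRootGroup D.apartment (D.param₆.mem t) (j := 6) le_rfl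
    rw [D.mul_x₁_eq_x₁_mul, normalForm, inr_line_five h₁ h₆]
    simp only [mul_smul, h₀]
  have h₂ : D.x₂ t'' • D.v 2 = D.v 2 :=
    smul_eq_of_mem_apartmentRootGroup D.apartment (D.param₂.mem t'') (j := 0) (by decide)
  have hU₁ (p : Γ.Collineation → Prop) :
      (∃ g ∈ Γ.apartmentRootGroup D.v 1, p g) ↔ ∃ b, p (D.x₁ b) := by
    constructor
    · rintro ⟨g, hg, hp⟩
      obtain ⟨b, rfl⟩ := D.param₁.exists_eq hg
      exact ⟨b, hp⟩
    · rintro ⟨b, hp⟩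
      exact ⟨_, D.param₁.mem b, hp⟩
  rw [inl_point_five h₁ h₆, hΓ.adj_smul_iff_exists D.apartment, hU₁, inr_line_four h₁ h₆,
    show (1 + 1 : ZMod (2 * 6)) = 2 by decide, sub_self, mul_smul _ (D.x₂ t''), h₂]
  simp only [hline]

theorem inc_five_five_iff (t t' t'' u u' : F) (a a' b b' b'' : J) :
    Γ.Inc (D.point s₁ s₆ (.five t a t' a' t'')) (D.line s₁ s₆ (.five b u b' u' b'')) ↔
      (u = t'' + t * H.N b - H.T a' b + H.T a (H.sharp b) ∧
       b' = a' - H.cross a b - t • H.sharp b ∧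
       u' = t' + t ^ 2 * H.N b - t * t'' + t * H.T a (H.sharp b) + H.T (H.sharp a) b
         - H.T a a' ∧
       b'' = a + t • b) := by
  have hline : Function.Injective (D.line s₁ s₆) :=
    (Sum.map_injective.1 (map_point_line_bijective hΓ h₁ h₆).injective).2
  refine (adj_inl_point_five_iff hΓ h₁ h₆ t a t' a' t'' (.inr _)).trans ?_
  simp only [Sum.inr.injEq, hline.eq_iff, reduceCtorEq, false_or, LineLabel.five.injEq,
    exists_eq_left']

end Reflections

end HexagonLabelling

theorem mainTheorem10 {P L F J : Type*} [Field F] [AddCommGroup J] [Module F J]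
    (Γ : PointLineGeometry P L) (hΓ : Γ.IsMoufangHexagon)
    (H : HexagonalSystem F J) (D : HexagonLabelling Γ H) :
    (∃ s₁, D.RepresentsS₁ s₁) ∧ (∃ s₆, D.RepresentsS₆ s₆) ∧
    ∀ s₁ s₆ : Γ.Collineation, D.RepresentsS₁ s₁ → D.RepresentsS₆ s₆ →
      Function.Bijective (D.point s₁ s₆) ∧ Function.Bijective (D.line s₁ s₆) ∧
      (∀ (p : PointLabel F J) (l : LineLabel F J), ¬ (p.IsGeneric ∧ l.IsGeneric) →
        (Γ.Inc (D.point s₁ s₆ p) (D.line s₁ s₆ l) ↔ ChainIncident p l)) ∧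
      ∀ (t t' t'' u u' : F) (a a' b b' b'' : J),
        (Γ.Inc (D.point s₁ s₆ (.five t a t' a' t'')) (D.line s₁ s₆ (.five b u b' u' b'')) ↔
          (u = t'' + t * H.N b - H.T a' b + H.T a (H.sharp b) ∧
           b' = a' - H.cross a b - t • H.sharp b ∧
           u' = t' + t ^ 2 * H.N b - t * t'' + t * H.T a (H.sharp b) + H.T (H.sharp a) b
             - H.T a a' ∧
           b'' = a + t • b)) ∧
        (Γ.Inc (D.point s₁ s₆ (.five t a t' a' t'')) (D.line s₁ s₆ (.five b u b' u' b'')) ↔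
          (a = b'' - t • b ∧
           t' = u' + t ^ 2 * H.N b + u * t - t * H.T b'' (H.sharp b) + H.T b' b''
             + H.T (H.sharp b'') b ∧
           a' = b' + H.cross b b'' - t • H.sharp b ∧
           t'' = u - t * H.N b + H.T b b' + H.T b'' (H.sharp b))) := by
  refine ⟨hΓ.exists_reflection D.apartment 7, hΓ.exists_reflection D.apartment 6, ?_⟩
  intro s₁ s₆ h₁ h₆
  have hbij := HexagonLabelling.map_point_line_bijective hΓ h₁ h₆
  refine ⟨(Sum.map_bijective.1 hbij).1, (Sum.map_bijective.1 hbij).2,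
    fun p l hpl => HexagonLabelling.inc_iff_chainIncident hΓ h₁ h₆ hpl, ?_⟩
  intro t t' t'' u u' a a' b b' b''
  have hinc := HexagonLabelling.inc_five_five_iff hΓ h₁ h₆ t t' t'' u u' a a' b b' b''
  exact ⟨hinc, hinc.trans (H.incidence_equations_iff t t' t'' u u' a a' b b' b'')⟩
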